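/- For $0<\alpha<2$, $-1\le\beta\le1$, $\gamma>0$, $\delta\in\mathbb R$ write $X\sim S(\alpha,\beta,\gamma,\delta;1)$ if the real random variable $X$ has characteristic function $$E e^{iuX}=\exp\!\big(-\gamma^\alpha\,[\,|u|^\alpha+i\beta\,\eta(u,\alpha)]+iu\delta\big),\qquad \eta(u,\alpha)=\begin{cases}-(\operatorname{sign}u)\tan(\pi\alpha/2)\,|u|^\alpha,&\alpha\ne1,\\ (2/\pi)\,u\ln|u|,&\alpha=1.\end{cases}$$ For real $x$ define $$g_d(x|\alpha,\beta)=\begin{cases}\int_0^\infty\cos(xr+\beta\eta(r,\alpha))\,r^{d-1}e^{-r^\alpha}\,dr,&d>0,\\ \int_0^\infty[\cos(xr+\beta\eta(r,\alpha))-1]\,r^{d-1}e^{-r^\alpha}\,dr,&-2\min(1,\alpha)<d\le0,\end{cases}$$ $$\tilde g_d(x|\alpha,\beta)=\begin{cases}\int_0^\infty\sin(xr+\beta\eta(r,\alpha))\,r^{d-1}e^{-r^\alpha}\,dr,&d>-\min(1,\alpha),\\ \int_0^\infty[\sin(xr+\beta\eta(r,\alpha))-xr]\,r^{d-1}e^{-r^\alpha}\,dr,&\alpha>1,\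 -\alpha<d\le-1.\end{cases}$$ Theorem. Let $X\sim S(\alpha,\beta,\gamma,\delta;1)$ with $0<\alpha<2$, $-1\le\beta\le1$, $\gamma>0$, $\delta\in\mathbb R$, and set $\delta^*=\delta/\gamma$ if $\alpha\ne1$ and $\delta^*=\delta/\gamma+(2/\pi)\beta\log\gamma$ if $\alpha=1$. For $p<\alpha$ let $m^p(\alpha,\beta,\gamma,\delta)=E X_+^p\in[0,\infty]$, where $X_+=\max(X,0)$ and $0^p$ is read as $0$ for every $p$ (so $E X_+^p=E[X^p\mathbf 1_{\{X>0\}}]$); this depends only on the parameters. For $0\le p<\alpha$ it is finite, and the integrals defining $g_{-p}(-\delta^*|\alpha,\beta)$ and $\tilde g_{-p}(-\delta^*|\alpha,\beta)$ converge absolutely. (a) When $p=0$, $$m^0(\alpha,\beta,\gamma,\delta)=P(X>0)=\frac12-\frac1\pi\,\tilde g_0(-\delta^*|\alpha,\beta).$$ When $0<p<\min(1,\alpha)$, $$m^p(\alpha,\beta,\gamma,\delta)=\gamma^p\,\frac{\Gamma(p+1)}{\pi}\Big[\sin\big(\tfrac{\pi p}2\big)\Big(\frac{\Gamma(1-p/\alpha)}p-g_{-p}(-\delta^*|\alpha,\beta)\Big)-\cos\big(\tfrac{\pi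 p}2\big)\,\tilde g_{-p}(-\delta^*|\alpha,\beta)\Big].$$ When $p=1<\alpha$, $$m^1(\alpha,\beta,\gamma,\delta)=\gamma\Big[\frac{\delta^*}2+\frac1\pi\big(\Gamma(1-1/\alpha)-g_{-1}(-\delta^*|\alpha,\beta)\big)\Big].$$ When $1<p<\alpha$, $$m^p(\alpha,\beta,\gamma,\delta)=\gamma^p\,\frac{\Gamma(p+1)}{\pi}\Big[\sin\big(\tfrac{\pi p}2\big)\Big(\frac{\Gamma(1-p/\alpha)}p-g_{-p}(-\delta^*|\alpha,\beta)\Big)+\cos\big(\tfrac{\pi p}2\big)\Big(\frac{\delta^*}\alpha\,\Gamma\big(\tfrac{1-p}\alpha\big)-\tilde g_{-p}(-\delta^*|\alpha,\beta)\Big)\Big].$$ (b) For every $p<\alpha$, with $X_-=\max(-X,0)$, $E X_-^p=E(-X)_+^p=m^p(\alpha,-\beta,\gamma,-\delta)$. -/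

import Mathlib

open MeasureTheory Set
open scoped ENNReal

noncomputable section

namespace StableMoments

/-- The function `η(u, α)` of the characteristic exponent. -/
def eta (u α : ℝ) : ℝ :=
  if α = 1 then (2 / Real.pi) * u * Real.log |u|
  else -(Real.sign u) * Real.tan (Real.pi * α / 2) * |u| ^ α

/-- The characteristic function
`exp (-γ^α (|u|^α + i β η(u, α)) + i u δ)` of the 1-parameterization. -/
def stableCF (α β γ δ u : ℝ) : ℂ :=
  Complex.exp (-((γ ^ α : ℝ) : ℂ) * (((|u| ^ α : ℝ) : ℂ) + Complex.I * (β : ℂ) * (eta u α : ℂ))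
    + Complex.I * (u : ℂ) * (δ : ℂ))

/-- `μ` is the stable law `S(α, β, γ, δ; 1)`: the probability measure on `ℝ` with
characteristic function `stableCF α β γ δ`. -/
structure IsStableLaw (α β γ δ : ℝ) (μ : Measure ℝ) : Prop where
  isProbabilityMeasure : IsProbabilityMeasure μ
  charFun_eq : ∀ u : ℝ, charFun μ u = stableCF α β γ δ u

/-- The random variable `X` satisfies `X ∼ S(α, β, γ, δ; 1)`. -/
def IsStable {Ω : Type*} [MeasurableSpace Ω] (P : Measure Ω) (X : Ω → ℝ) (α β γ δ : ℝ) : Prop :=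
  AEMeasurable X P ∧ IsStableLaw α β γ δ (P.map X)

open Classical in
/-- The law `S(α, β, γ, δ; 1)` itself. A probability measure on `ℝ` is determined by its
characteristic function, so there is at most one candidate to choose from. -/
def stableLaw (α β γ δ : ℝ) : Measure ℝ :=
  if h : ∃ μ : Measure ℝ, IsStableLaw α β γ δ μ then h.choose else 0

/-- The law of a stable random variable is `stableLaw` of its parameters. -/
theorem IsStableLaw.eq_stableLaw {α β γ δ : ℝ} {μ : Measure ℝ} (h : IsStableLaw α β γ δ μ) :
    μ = stableLaw α β γ δ := by
  have hex : ∃ μ : Measure ℝ, IsStableLaw α β γ δ μ := ⟨μ, h⟩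
  rw [stableLaw, dif_pos hex]
  have h2 := hex.choose_spec
  haveI := h.isProbabilityMeasure
  haveI := h2.isProbabilityMeasure
  apply Measure.ext_of_charFun
  funext u
  rw [h.charFun_eq, h2.charFun_eq]

/-- The power `y ^ p` of `y ≥ 0` with the convention `0 ^ p = 0` for every `p`, so that
`E X₊^p` is the integral of `X ^ p` over `{X > 0}`, and `E X₊^0 = P(X > 0)`. -/
def truncPow (y p : ℝ) : ℝ≥0∞ :=
  if y = 0 then 0 else ENNReal.ofReal (y ^ p)

/-- For positive `p` this is the usual power. -/
theorem truncPow_of_pos (y : ℝ) {p : ℝ} (hp : 0 < p) : truncPow y p = ENNReal.ofReal (y ^ p) := by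
  unfold truncPow
  split_ifs with h
  · simp [h, Real.zero_rpow hp.ne']
  · rfl

/-- `E X₊^p`, as an element of `[0, ∞]`. -/
def posMoment {Ω : Type*} [MeasurableSpace Ω] (P : Measure Ω) (X : Ω → ℝ) (p : ℝ) : ℝ≥0∞ :=
  ∫⁻ ω, truncPow (X ω)⁺ p ∂P

/-- `E X₋^p`, as an element of `[0, ∞]`. -/
def negMoment {Ω : Type*} [MeasurableSpace Ω] (P : Measure Ω) (X : Ω → ℝ) (p : ℝ) : ℝ≥0∞ :=
  ∫⁻ ω, truncPow (X ω)⁻ p ∂P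

/-- `m^p(α, β, γ, δ) = E X₊^p` for `X ∼ S(α, β, γ, δ; 1)`. -/
def m (p α β γ δ : ℝ) : ℝ≥0∞ :=
  posMoment (stableLaw α β γ δ) (fun x => x) p

/-- The integrand of `g_d(x | α, β)`. -/
def gIntegrand (d x α β r : ℝ) : ℝ :=
  if 0 < d then Real.cos (x * r + β * eta r α) * r ^ (d - 1) * Real.exp (-r ^ α)
  else (Real.cos (x * r + β * eta r α) - 1) * r ^ (d - 1) * Real.exp (-r ^ α)

/-- `g_d(x | α, β)`, meant for `d > -2 min(1, α)`. -/
def g (d x α β : ℝ) : ℝ := ∫ r in Ioi (0 : ℝ), gIntegrand d x α β r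

/-- The integrand of `g̃_d(x | α, β)`. -/
def gtIntegrand (d x α β r : ℝ) : ℝ :=
  if -min 1 α < d then Real.sin (x * r + β * eta r α) * r ^ (d - 1) * Real.exp (-r ^ α)
  else (Real.sin (x * r + β * eta r α) - x * r) * r ^ (d - 1) * Real.exp (-r ^ α)

/-- `g̃_d(x | α, β)`, meant for `d > -min(1, α)`, and for `-α < d ≤ -1` if `α > 1`. -/
def gt (d x α β : ℝ) : ℝ := ∫ r in Ioi (0 : ℝ), gtIntegrand d x α β r

/-- The normalized shift `δ*`. -/
def deltaStar (α β γ δ : ℝ) : ℝ :=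
  if α = 1 then δ / γ + (2 / Real.pi) * β * Real.log γ else δ / γ

end StableMoments

end

/-! By homogeneity, for real `y`, `∫₀^∞ (1 - cos (r y)) r^(-p-1) dr` is a constant times `|y|^p`
when `0 < p < 2`. The kernel `sin (r y)` for `0 < p < 1`, and `r y - sin (r y)` for `1 < p < 2`,
gives in the same way a constant times `sign y * |y|^p`. Integrating over the law of `Y = X / γ` and
exchanging integrals expresses the absolute and signed moments of `Y` through the real and imaginary
parts of its characteristic function, which are `e^(-r^α)` times the cosine and minus the sine of
the phase `x r + β η(r, α)`, with `x = -δ*`. Half the sum of the two moments is `E Y₊^p`, and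
scaling by `γ^p` gives `m^p`.

The terms free of `β` come from `1 - c e = (1 - e) - (c - 1) e`: the integral of `(1 - e^(-r^α))
r^(-q-1)` is `Γ(1 - q/α) / q`, used at `q = p` for the cosine and at `q = p - 1` for the compensated
sine (`integral_one_sub_exp_mul_rpow`). The kernel constants follow by writing `r^(-p-1)` as a Gamma
integral: the Laplace transforms of the kernels are rational, and the remaining integrals reduce to
the reflection formula.

Finiteness of the moments comes from the nonnegative kernel `1 - cos`. At `p = 1` the signed moment
is the mean `-x`, the derivative of the characteristic function at `0` up to a factor `i`. The case
`p = 0` is the limit `p → 0+`, and (b) holds because `-X` is stable with `β` and `δ` negated. -/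

noncomputable section

namespace StableMoments

open Filter Topology

/-! ### Power moments through Laplace transforms -/

/-- Integrability on the half-line from a power bound near `0` and an integrable bound elsewhere. -/
theorem integrableOn_Ioi_zero_of_bounds {f h : ℝ → ℝ} {C a : ℝ}
    (hf : AEStronglyMeasurable f (volume.restrict (Ioi 0))) (ha : -1 < a)
    (h0 : ∀ r, 0 < r → r ≤ 1 → |f r| ≤ C * r ^ a)
    (hh : IntegrableOn h (Ioi 1)) (h1 : ∀ r, 1 < r → |f r| ≤ h r) :
    IntegrableOn f (Ioi 0) := by
  rw [← Ioc_union_Ioi_eq_Ioi (zero_le_one (α := ℝ)), integrableOn_union]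
  constructor
  · have hint : IntegrableOn (fun r : ℝ => C * r ^ a) (Ioc 0 1) := by
      have := (intervalIntegral.intervalIntegrable_rpow' (a := 0) (b := 1) ha).const_mul C
      rwa [intervalIntegrable_iff_integrableOn_Ioc_of_le zero_le_one] at this
    refine Integrable.mono' hint (hf.mono_measure (Measure.restrict_mono Ioc_subset_Ioi_self le_rfl)) ?_
    filter_upwards [ae_restrict_mem measurableSet_Ioc] with r hr
    exact h0 r hr.1 hr.2
  · refine Integrable.mono' hh (hf.mono_measure
      (Measure.restrict_mono (Ioi_subset_Ioi zero_le_one) le_rfl)) ?_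
    filter_upwards [ae_restrict_mem measurableSet_Ioi] with r hr
    exact h1 r hr

theorem integrableOn_rpow_mul_exp_neg_mul {p r : ℝ} (hp : -1 < p) (hr : 0 < r) :
    IntegrableOn (fun t : ℝ => t ^ p * Real.exp (-(r * t))) (Ioi 0) := by
  refine (integrableOn_rpow_mul_exp_neg_mul_rpow (p := 1) hp one_pos hr).congr_fun ?_
    measurableSet_Ioi
  intro t _
  simp [neg_mul]

/-- Writing `r ^ (-p - 1)` as a Gamma integral turns a power moment of `f` into a power moment of
its Laplace transform. -/
theorem integral_mul_rpow_eq_integral_laplace {f : ℝ → ℝ} {p : ℝ} (hf : Measurable f) (hp : -1 < p)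
    (hint : IntegrableOn (fun r => f r * r ^ (-p - 1)) (Ioi 0)) :
    (∫ r in Ioi (0 : ℝ), f r * r ^ (-p - 1)) * Real.Gamma (p + 1) =
      ∫ t in Ioi (0 : ℝ), t ^ p * ∫ r in Ioi (0 : ℝ), f r * Real.exp (-(r * t)) := by
  have hG : ∀ r : ℝ, 0 < r → ∫ t in Ioi (0 : ℝ), t ^ p * Real.exp (-(r * t)) =
      r ^ (-p - 1) * Real.Gamma (p + 1) := by
    intro r hr
    have := Real.integral_rpow_mul_exp_neg_mul_Ioi (a := p + 1) (by linarith) hr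
    simp only [add_sub_cancel_right] at this
    rw [this, one_div, Real.inv_rpow hr.le, ← Real.rpow_neg hr.le]
    ring_nf
  -- The weight in `t` is nonnegative, so integrating the norm over `t` first leaves `|f r| r^(-p-1)
  -- Γ(p+1)`, which is integrable by `hint`.
  have hprod : Integrable (Function.uncurry fun r t : ℝ => f r * (t ^ p * Real.exp (-(r * t))))
      ((volume.restrict (Ioi 0)).prod (volume.restrict (Ioi 0))) := by
    have hm : Measurable (Function.uncurry fun r t : ℝ =>
        f r * (t ^ p * Real.exp (-(r * t)))) := by
      unfold Function.uncurry
      fun_prop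
    rw [integrable_prod_iff hm.aestronglyMeasurable]
    constructor
    · filter_upwards [ae_restrict_mem measurableSet_Ioi] with r hr
      exact (integrableOn_rpow_mul_exp_neg_mul hp hr).const_mul (f r)
    · refine (hint.norm.mul_const (Real.Gamma (p + 1))).congr ?_
      filter_upwards [ae_restrict_mem measurableSet_Ioi] with r hr
      have : ∀ t ∈ Ioi (0 : ℝ), ‖Function.uncurry (fun r t : ℝ =>
          f r * (t ^ p * Real.exp (-(r * t)))) (r, t)‖ =
          |f r| * (t ^ p * Real.exp (-(r * t))) := by
        intro t ht
        have ht' : (0 : ℝ) < t := ht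
        simp only [Function.uncurry, Real.norm_eq_abs, abs_mul, Real.abs_exp]
        rw [abs_of_pos (Real.rpow_pos_of_pos ht' p)]
      rw [setIntegral_congr_fun measurableSet_Ioi this, integral_const_mul, hG r hr,
        Real.norm_eq_abs, abs_mul, abs_of_pos (Real.rpow_pos_of_pos hr _)]
      ring
  have hswap := integral_integral_swap hprod
  rw [← integral_mul_const]
  calc _ = ∫ r in Ioi (0 : ℝ), ∫ t in Ioi (0 : ℝ), f r * (t ^ p * Real.exp (-(r * t))) := by
        refine setIntegral_congr_fun measurableSet_Ioi fun r hr => ?_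
        rw [integral_const_mul, hG r hr, mul_assoc]
    _ = _ := by
        rw [hswap]
        refine integral_congr_ae (Eventually.of_forall fun t => ?_)
        simp only
        rw [← integral_const_mul]
        congr 1
        ext r
        ring

/-- The Laplace transform of `e^(-r)` is `1 / (1 + t)`; the Gamma-integral exchange turns the left
side into `Γ(1-s) Γ(s)`, and the reflection formula applies. -/
theorem integral_rpow_div_one_add {s : ℝ} (h0 : 0 < s) (h1 : s < 1) :
    ∫ t in Ioi (0 : ℝ), t ^ (s - 1) * (1 / (1 + t)) = Real.pi / Real.sin (Real.pi * s) := by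
  have hconv := Real.GammaIntegral_convergent (s := 1 - s) (by linarith)
  have hexp : (1 - s - 1 : ℝ) = -(s - 1) - 1 := by ring
  have key := integral_mul_rpow_eq_integral_laplace (f := fun r => Real.exp (-r)) (p := s - 1)
    (by fun_prop) (by linarith) (by rw [← hexp]; exact hconv)
  rw [← hexp, ← Real.Gamma_eq_integral (by linarith), sub_add_cancel, mul_comm,
    Real.Gamma_mul_Gamma_one_sub] at key
  rw [key]
  refine setIntegral_congr_fun measurableSet_Ioi fun t ht => ?_
  have ht' : (0 : ℝ) < t := ht
  congr 1
  have := integral_exp_mul_Ioi (a := -(1 + t)) (by linarith) 0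
  simp only [mul_zero, Real.exp_zero, neg_div_neg_eq] at this
  rw [← this]
  congr 1
  ext r
  rw [← Real.exp_add]
  ring_nf

/-- The substitution `t ↦ t²` in the previous integral at exponent `s / 2`, which is why the range
of `s` doubles. -/
theorem integral_rpow_div_one_add_sq {s : ℝ} (h0 : 0 < s) (h2 : s < 2) :
    ∫ t in Ioi (0 : ℝ), t ^ (s - 1) * (1 / (1 + t ^ 2)) =
      Real.pi / (2 * Real.sin (Real.pi * s / 2)) := by
  have h := integral_rpow_div_one_add (s := s / 2) (by linarith) (by linarith)
  rw [← integral_comp_rpow_Ioi_of_pos (p := 2) (by norm_num)] at h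
  have h' : ∫ t in Ioi (0 : ℝ), 2 * (t ^ (s - 1) * (1 / (1 + t ^ 2))) =
      Real.pi / Real.sin (Real.pi * (s / 2)) := by
    rw [← h]
    refine setIntegral_congr_fun measurableSet_Ioi fun t ht => ?_
    have ht' : (0 : ℝ) < t := ht
    simp only [smul_eq_mul]
    rw [← Real.rpow_mul ht'.le, Real.rpow_two]
    have : t ^ (s - 1) = t ^ ((2 : ℝ) - 1) * t ^ (2 * (s / 2 - 1)) := by
      rw [← Real.rpow_add ht']
      ring_nf
    rw [this]
    ring
  rw [integral_const_mul] at h'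
  rw [mul_div_assoc, mul_comm (2 : ℝ), ← div_div, ← h']
  ring

/-! ### The kernels `1 - cos`, `sin`, `r - sin r` and their constants -/

theorem abs_self_sub_sin_le (y : ℝ) : |y - Real.sin y| ≤ y ^ 2 * 2 := by
  wlog hy : 0 ≤ y generalizing y
  · have := this (-y) (by linarith)
    rw [Real.sin_neg, ← abs_neg] at this
    simpa [sub_eq_add_neg, add_comm] using this
  rw [abs_of_nonneg (by linarith [Real.sin_le hy])]
  rcases hy.eq_or_lt with rfl | hpos
  · simp
  rcases le_or_gt y 1 with h | h
  · have := Real.sin_gt_sub_cube hpos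
    nlinarith [mul_nonneg (sq_nonneg y) (sub_nonneg.2 h)]
  · nlinarith [Real.neg_one_le_sin y]

/-- The order of vanishing at `0` bounds `p` above and the growth at infinity bounds it below. Here
the order is two and the kernel is bounded; `sin r` has order one; `r - sin r` is `O(r²)` at `0` but
grows linearly, hence `1 < p` for it. -/
theorem integrableOn_one_sub_cos_mul_rpow {p : ℝ} (h0 : 0 < p) (h2 : p < 2) :
    IntegrableOn (fun r => (1 - Real.cos r) * r ^ (-p - 1)) (Ioi 0) := by
  refine integrableOn_Ioi_zero_of_bounds (C := 1) (a := 1 - p) (h := fun r => 2 * r ^ (-p - 1))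
    (by fun_prop) (by linarith) ?_ ?_ ?_
  · intro r hr _
    rw [abs_of_nonneg (mul_nonneg (by linarith [Real.cos_le_one r]) (by positivity)), one_mul]
    have : r ^ (1 - p) = r ^ 2 * r ^ (-p - 1) := by
      rw [← Real.rpow_two, ← Real.rpow_add hr]; ring_nf
    rw [this]
    have := Real.one_sub_sq_div_two_le_cos (x := r)
    gcongr
    nlinarith [sq_nonneg r]
  · exact (integrableOn_Ioi_rpow_of_lt (by linarith) one_pos).const_mul 2
  · intro r hr
    have hr0 : 0 < r := by linarith
    rw [abs_of_nonneg (mul_nonneg (by linarith [Real.cos_le_one r]) (by positivity))]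
    gcongr
    linarith [Real.neg_one_le_cos r]

theorem integrableOn_sin_mul_rpow {p : ℝ} (h0 : 0 < p) (h1 : p < 1) :
    IntegrableOn (fun r => Real.sin r * r ^ (-p - 1)) (Ioi 0) := by
  refine integrableOn_Ioi_zero_of_bounds (C := 1) (a := - p) (h := fun r => r ^ (-p - 1))
    (by fun_prop) (by linarith) ?_ ?_ ?_
  · intro r hr _
    rw [abs_mul, abs_of_pos (Real.rpow_pos_of_pos hr _), one_mul]
    have : r ^ (-p) = r * r ^ (-p - 1) := by
      rw [← Real.rpow_one_add' hr.le (by linarith)]; ring_nf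
    rw [this]
    gcongr
    exact (Real.abs_sin_le_abs (x := r)).trans_eq (abs_of_pos hr)
  · exact integrableOn_Ioi_rpow_of_lt (by linarith) one_pos
  · intro r hr
    have hr0 : 0 < r := by linarith
    rw [abs_mul, abs_of_pos (Real.rpow_pos_of_pos hr0 _)]
    exact mul_le_of_le_one_left (by positivity) (Real.abs_sin_le_one r)

theorem integrableOn_sub_sin_mul_rpow {p : ℝ} (h1 : 1 < p) (h2 : p < 2) :
    IntegrableOn (fun r => (r - Real.sin r) * r ^ (-p - 1)) (Ioi 0) := by
  refine integrableOn_Ioi_zero_of_bounds (C := 2) (a := 1 - p) (h := fun r => 2 * r ^ (-p))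
    (by fun_prop) (by linarith) ?_ ?_ ?_
  · intro r hr _
    rw [abs_mul, abs_of_pos (Real.rpow_pos_of_pos hr _)]
    have : r ^ (1 - p) = r ^ 2 * r ^ (-p - 1) := by
      rw [← Real.rpow_two, ← Real.rpow_add hr]; ring_nf
    rw [this, ← mul_assoc, mul_comm 2]
    gcongr
    exact abs_self_sub_sin_le r
  · exact (integrableOn_Ioi_rpow_of_lt (by linarith) one_pos).const_mul 2
  · intro r hr
    have hr0 : 0 < r := by linarith
    rw [abs_mul, abs_of_pos (Real.rpow_pos_of_pos hr0 _)]
    have : r ^ (-p) = r * r ^ (-p - 1) := by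
      rw [← Real.rpow_one_add' hr0.le (by linarith)]; ring_nf
    rw [this, ← mul_assoc]
    gcongr
    rw [abs_of_nonneg (by linarith [Real.sin_le hr0.le])]
    linarith [Real.neg_one_le_sin r]

theorem laplace_exp_mul_I {t : ℝ} (ht : 0 < t) :
    IntegrableOn (fun r : ℝ => Complex.exp ((-t + Complex.I) * r)) (Ioi 0) ∧
    ∫ r in Ioi (0 : ℝ), Complex.exp ((-t + Complex.I) * r) =
      ((t / (1 + t ^ 2) : ℝ) : ℂ) + ((1 / (1 + t ^ 2) : ℝ) : ℂ) * Complex.I := by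
  have hre : (-(t : ℂ) + Complex.I).re < 0 := by simpa using ht
  refine ⟨integrableOn_exp_mul_complex_Ioi hre 0, ?_⟩
  rw [integral_exp_mul_complex_Ioi hre 0]
  have h1 : (1 + (t : ℂ) ^ 2) ≠ 0 := by
    have : (1 + t ^ 2 : ℝ) ≠ 0 := by positivity
    exact_mod_cast this
  have h2 : (-(t : ℂ) + Complex.I) ≠ 0 := by
    intro h
    rw [h] at hre
    simp at hre
  push_cast
  simp only [mul_zero, Complex.exp_zero]
  field_simp
  ring_nf
  rw [Complex.I_sq]
  ring

theorem integrableOn_cos_mul_exp {t : ℝ} (ht : 0 < t) :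
    IntegrableOn (fun r : ℝ => Real.cos r * Real.exp (-(r * t))) (Ioi 0) := by
  refine (laplace_exp_mul_I ht).1.re.congr (Eventually.of_forall fun r => ?_)
  simp [Complex.exp_re, mul_comm]

theorem integrableOn_sin_mul_exp {t : ℝ} (ht : 0 < t) :
    IntegrableOn (fun r : ℝ => Real.sin r * Real.exp (-(r * t))) (Ioi 0) := by
  refine (laplace_exp_mul_I ht).1.im.congr (Eventually.of_forall fun r => ?_)
  simp [Complex.exp_im, mul_comm]

theorem integral_cos_mul_exp {t : ℝ} (ht : 0 < t) :
    ∫ r in Ioi (0 : ℝ), Real.cos r * Real.exp (-(r * t)) = t / (1 + t ^ 2) := by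
  have h := congrArg Complex.re (laplace_exp_mul_I ht).2
  rw [← RCLike.re_eq_complex_re, ← integral_re (laplace_exp_mul_I ht).1] at h
  have e : ∀ r : ℝ, RCLike.re (Complex.exp ((-t + Complex.I) * r)) =
      Real.cos r * Real.exp (-(r * t)) := fun r => by simp [Complex.exp_re, mul_comm]
  simp only [e] at h
  rw [h]
  simp [-Complex.ofReal_div, -Complex.ofReal_inv, -one_div]

theorem integral_sin_mul_exp {t : ℝ} (ht : 0 < t) :
    ∫ r in Ioi (0 : ℝ), Real.sin r * Real.exp (-(r * t)) = 1 / (1 + t ^ 2) := by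
  have h := congrArg Complex.im (laplace_exp_mul_I ht).2
  rw [← RCLike.im_eq_complex_im, ← integral_im (laplace_exp_mul_I ht).1] at h
  have e : ∀ r : ℝ, RCLike.im (Complex.exp ((-t + Complex.I) * r)) =
      Real.sin r * Real.exp (-(r * t)) := fun r => by simp [Complex.exp_im, mul_comm]
  simp only [e] at h
  rw [h]
  simp [-Complex.ofReal_div, -Complex.ofReal_inv, -one_div]

/-- The Laplace transform of the kernel is `1/t - t/(1+t²) = 1/(t (1+t²))`, so the moment is that of
`1/(1+t²)` at `s = p`. For `sin r` and `r - sin r` below, the transforms `1/(1+t²)` and `1/(t²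
(1+t²))` give `s = p + 1` and `s = p - 1`, whose sines are plus and minus the same cosine. -/
theorem integral_one_sub_cos_mul_rpow {p : ℝ} (h0 : 0 < p) (h2 : p < 2) :
    (∫ r in Ioi (0 : ℝ), (1 - Real.cos r) * r ^ (-p - 1)) * Real.Gamma (p + 1) =
      Real.pi / (2 * Real.sin (Real.pi * p / 2)) := by
  rw [integral_mul_rpow_eq_integral_laplace (by fun_prop) (by linarith)
    (integrableOn_one_sub_cos_mul_rpow h0 h2), ← integral_rpow_div_one_add_sq h0 h2]
  refine setIntegral_congr_fun measurableSet_Ioi fun t ht => ?_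
  have ht' : (0 : ℝ) < t := ht
  have he : IntegrableOn (fun r : ℝ => Real.exp (-(r * t))) (Ioi 0) := by
    refine (integrableOn_exp_mul_Ioi (a := -t) (by linarith) 0).congr
      (Eventually.of_forall fun r => ?_)
    ring_nf
  have he' : ∫ r in Ioi (0 : ℝ), Real.exp (-(r * t)) = 1 / t := by
    have := integral_exp_mul_Ioi (a := -t) (by linarith) 0
    simp only [mul_zero, Real.exp_zero, neg_div_neg_eq] at this
    rw [← this]
    congr 1
    ext r
    ring_nf
  have : ∫ r in Ioi (0 : ℝ), (1 - Real.cos r) * Real.exp (-(r * t)) = 1 / t - t / (1 + t ^ 2) := by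
    simp only [sub_mul, one_mul]
    rw [integral_sub he (integrableOn_cos_mul_exp ht'), he', integral_cos_mul_exp ht']
  rw [this, Real.rpow_sub_one ht'.ne']
  field_simp
  ring

theorem sin_pi_mul_add_one_div_two (p : ℝ) :
    Real.sin (Real.pi * (p + 1) / 2) = Real.cos (Real.pi * p / 2) := by
  rw [← Real.sin_add_pi_div_two]
  ring_nf

theorem sin_pi_mul_sub_one_div_two (p : ℝ) :
    Real.sin (Real.pi * (p - 1) / 2) = -Real.cos (Real.pi * p / 2) := by
  rw [← Real.sin_sub_pi_div_two]
  ring_nf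

theorem integral_sin_mul_rpow {p : ℝ} (h0 : 0 < p) (h1 : p < 1) :
    (∫ r in Ioi (0 : ℝ), Real.sin r * r ^ (-p - 1)) * Real.Gamma (p + 1) =
      Real.pi / (2 * Real.cos (Real.pi * p / 2)) := by
  rw [integral_mul_rpow_eq_integral_laplace (by fun_prop) (by linarith)
    (integrableOn_sin_mul_rpow h0 h1), ← sin_pi_mul_add_one_div_two,
    ← integral_rpow_div_one_add_sq (by linarith) (by linarith)]
  refine setIntegral_congr_fun measurableSet_Ioi fun t ht => ?_
  rw [integral_sin_mul_exp ht, add_sub_cancel_right]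

theorem integral_sub_sin_mul_rpow {p : ℝ} (h1 : 1 < p) (h2 : p < 2) :
    (∫ r in Ioi (0 : ℝ), (r - Real.sin r) * r ^ (-p - 1)) * Real.Gamma (p + 1) =
      Real.pi / (2 * -Real.cos (Real.pi * p / 2)) := by
  rw [integral_mul_rpow_eq_integral_laplace (by fun_prop) (by linarith)
    (integrableOn_sub_sin_mul_rpow h1 h2), ← sin_pi_mul_sub_one_div_two,
    ← integral_rpow_div_one_add_sq (by linarith) (by linarith)]
  refine setIntegral_congr_fun measurableSet_Ioi fun t ht => ?_
  have ht' : (0 : ℝ) < t := ht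
  have he : IntegrableOn (fun r : ℝ => r * Real.exp (-(r * t))) (Ioi 0) := by
    refine (integrableOn_rpow_mul_exp_neg_mul (p := 1) (by norm_num) ht').congr
      (Eventually.of_forall fun r => ?_)
    simp [mul_comm]
  have he' : ∫ r in Ioi (0 : ℝ), r * Real.exp (-(r * t)) = 1 / t ^ 2 := by
    have := Real.integral_rpow_mul_exp_neg_mul_Ioi (a := 2) (by norm_num) ht'
    norm_num at this
    rw [one_div, ← this]
    congr 1
    ext r
    rw [mul_comm r t]
  have : ∫ r in Ioi (0 : ℝ), (r - Real.sin r) * Real.exp (-(r * t)) =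
      1 / t ^ 2 - 1 / (1 + t ^ 2) := by
    simp only [sub_mul]
    rw [integral_sub he (integrableOn_sin_mul_exp ht'), he', integral_sin_mul_exp ht']
  rw [this, Real.rpow_sub_one ht'.ne', Real.rpow_sub_one ht'.ne']
  field_simp
  ring

/-! ### The Gamma term -/

theorem integrableOn_one_sub_exp_mul_rpow {α q : ℝ} (h0 : 0 < q) (hq : q < α) :
    IntegrableOn (fun r => (1 - Real.exp (-r ^ α)) * r ^ (-q - 1)) (Ioi 0) := by
  have hnn : ∀ r : ℝ, 0 < r → 0 ≤ 1 - Real.exp (-r ^ α) := fun r hr => by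
    have : Real.exp (-r ^ α) ≤ 1 :=
      Real.exp_le_one_iff.2 (by simpa using (Real.rpow_pos_of_pos hr α).le)
    linarith
  refine integrableOn_Ioi_zero_of_bounds (C := 1) (a := α - q - 1) (h := fun r => r ^ (-q - 1))
    (by fun_prop) (by linarith) ?_ ?_ ?_
  · intro r hr _
    rw [abs_of_nonneg (mul_nonneg (hnn r hr) (by positivity)), one_mul]
    have : r ^ (α - q - 1) = r ^ α * r ^ (-q - 1) := by
      rw [← Real.rpow_add hr]; ring_nf
    rw [this]
    gcongr
    linarith [Real.add_one_le_exp (-r ^ α)]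
  · exact integrableOn_Ioi_rpow_of_lt (by linarith) one_pos
  · intro r hr
    have hr0 : 0 < r := by linarith
    rw [abs_of_nonneg (mul_nonneg (hnn r hr0) (by positivity))]
    exact mul_le_of_le_one_left (by positivity) (by linarith [Real.exp_pos (-r ^ α)])

/-- Integration by parts against `-r^(-q)/q` leaves a Gamma integral. The boundary term vanishes at
`0` because `1 - e^(-r^α) ≤ r^α` and `q < α`, and at infinity because `q > 0`. -/
theorem integral_one_sub_exp_mul_rpow {α q : ℝ} (h0 : 0 < q) (hq : q < α) :
    ∫ r in Ioi (0 : ℝ), (1 - Real.exp (-r ^ α)) * r ^ (-q - 1) = Real.Gamma (1 - q / α) / q := by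
  have hα : 0 < α := h0.trans hq
  have hnn : ∀ r : ℝ, 0 < r → 0 ≤ 1 - Real.exp (-r ^ α) := fun r hr => by
    have : Real.exp (-r ^ α) ≤ 1 :=
      Real.exp_le_one_iff.2 (by simpa using (Real.rpow_pos_of_pos hr α).le)
    linarith
  have hI := integrableOn_one_sub_exp_mul_rpow h0 hq
  have hJ := integrableOn_rpow_mul_exp_neg_rpow (p := α) (s := α - q - 1) (by linarith) hα
  have hu'v : ∀ r ∈ Ioi (0 : ℝ), (-α / q) * (r ^ (α - q - 1) * Real.exp (-r ^ α)) =
      (Real.exp (-r ^ α) * (α * r ^ (α - 1))) * (r ^ (-q) / -q) := by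
    intro r hr
    have hr' : (0 : ℝ) < r := hr
    have : r ^ (α - q - 1) = r ^ (α - 1) * r ^ (-q) := by
      rw [← Real.rpow_add hr']; ring_nf
    rw [this]
    field_simp
  have key := integral_Ioi_mul_deriv_eq_deriv_mul (a := 0) (a' := 0) (b' := 0)
    (u := fun r => 1 - Real.exp (-r ^ α)) (u' := fun r => Real.exp (-r ^ α) * (α * r ^ (α - 1)))
    (v := fun r => r ^ (-q) / -q) (v' := fun r => r ^ (-q - 1)) ?_ ?_ hI ?_ ?_ ?_
  · rw [key, ← setIntegral_congr_fun measurableSet_Ioi hu'v, integral_const_mul,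
      integral_rpow_mul_exp_neg_rpow hα (by linarith)]
    have : (α - q - 1 + 1) / α = 1 - q / α := by field_simp; ring
    rw [this]
    field_simp
    ring
  · intro r hr
    have h := ((Real.hasDerivAt_rpow_const (x := r) (p := α) (Or.inl (ne_of_gt hr))).neg.exp).const_sub 1
    rw [mul_neg, neg_neg] at h
    exact h
  · intro r hr
    have h := (Real.hasDerivAt_rpow_const (x := r) (p := -q) (Or.inl (ne_of_gt hr))).div_const (-q)
    convert h using 1
    field_simp
  · have : IntegrableOn (fun r => (-α / q) * (r ^ (α - q - 1) * Real.exp (-r ^ α))) (Ioi 0) :=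
      hJ.const_mul (-α / q)
    exact this.congr_fun hu'v measurableSet_Ioi
  · have hlim : Tendsto (fun r : ℝ => r ^ (α - q) / q) (𝓝[>] 0) (𝓝 0) := by
      have : Tendsto (fun r : ℝ => r ^ (α - q) / q) (𝓝 0) (𝓝 ((0 : ℝ) ^ (α - q) / q)) :=
        ((Real.continuousAt_rpow_const 0 (α - q) (Or.inr (by linarith))).div_const q)
      rw [Real.zero_rpow (by linarith), zero_div] at this
      exact this.mono_left nhdsWithin_le_nhds
    refine squeeze_zero_norm' ?_ hlim
    filter_upwards [self_mem_nhdsWithin] with r hr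
    have hr' : (0 : ℝ) < r := hr
    simp only [Pi.mul_apply, norm_mul, norm_div, Real.norm_eq_abs, abs_neg, abs_of_pos h0]
    rw [abs_of_nonneg (hnn r hr'), abs_of_pos (Real.rpow_pos_of_pos hr' _),
      sub_eq_add_neg α, Real.rpow_add hr', mul_div_assoc]
    gcongr
    linarith [Real.add_one_le_exp (-r ^ α)]
  · have hlim : Tendsto (fun r : ℝ => r ^ (-q) / q) atTop (𝓝 0) := by
      simpa using (tendsto_rpow_neg_atTop h0).div_const q
    refine squeeze_zero_norm' ?_ hlim
    filter_upwards [eventually_gt_atTop 0] with r hr'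
    simp only [Pi.mul_apply, norm_mul, norm_div, Real.norm_eq_abs, abs_neg, abs_of_pos h0]
    rw [abs_of_nonneg (hnn r hr'), abs_of_pos (Real.rpow_pos_of_pos hr' _)]
    exact mul_le_of_le_one_left (by positivity) (by linarith [Real.exp_pos (-r ^ α)])

/-! ### The phase near the origin and absolute convergence of `g` and `gt` -/

theorem measurable_eta (α : ℝ) : Measurable fun r => eta r α := by
  unfold eta
  split_ifs
  · fun_prop
  · refine Measurable.mul (Measurable.mul_const ?_ _) (by fun_prop)
    refine Measurable.neg ?_
    unfold Real.sign
    exact Measurable.ite measurableSet_Iio measurable_const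
      (Measurable.ite measurableSet_Ioi measurable_const measurable_const)

theorem measurable_phase (x α β : ℝ) : Measurable fun r => x * r + β * eta r α :=
  (measurable_id.const_mul x).add ((measurable_eta α).const_mul β)

theorem abs_eta_of_ne_one {α r : ℝ} (hα : α ≠ 1) (hr : 0 < r) :
    |eta r α| = |Real.tan (Real.pi * α / 2)| * r ^ α := by
  rw [eta, if_neg hα, Real.sign_of_pos hr, abs_of_pos hr, abs_mul, abs_mul, abs_neg, abs_one,
    one_mul, abs_of_pos (Real.rpow_pos_of_pos hr α)]

/-- The exponent stays strictly below `min 1 α` to absorb the logarithm at `α = 1`; for `α ≠ 1` the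
function `η` has exact order `r^α`. -/
theorem exists_abs_phase_le (x β : ℝ) {α a : ℝ} (ha : a < min 1 α) :
    ∃ C, ∀ r, 0 < r → r ≤ 1 → |x * r + β * eta r α| ≤ C * r ^ a := by
  obtain ⟨D, hD⟩ : ∃ D, ∀ r, 0 < r → r ≤ 1 → |eta r α| ≤ D * r ^ a := by
    by_cases hα : α = 1
    · refine ⟨2 / Real.pi * (1 / (1 - a)), fun r hr hr1 => ?_⟩
      have ha1 : a < 1 := ha.trans_le (min_le_left _ _)
      have hlog := Real.abs_log_mul_self_rpow_lt r (1 - a) hr hr1 (by linarith)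
      have hsplit : r = r ^ (1 - a) * r ^ a := by
        rw [← Real.rpow_add hr]; simp
      have hpos := Real.pi_pos
      have e : eta r α = 2 / Real.pi * (Real.log r * r ^ (1 - a)) * r ^ a := by
        rw [eta, if_pos hα, abs_of_pos hr]
        conv_lhs => rw [mul_assoc, mul_comm r]; enter [2, 2]; rw [hsplit]
        ring
      rw [e, abs_mul, abs_mul, abs_of_pos (Real.rpow_pos_of_pos hr a), abs_of_pos (by positivity)]
      gcongr
    · refine ⟨|Real.tan (Real.pi * α / 2)|, fun r hr hr1 => ?_⟩
      rw [abs_eta_of_ne_one hα hr]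
      exact mul_le_mul_of_nonneg_left
        (Real.rpow_le_rpow_of_exponent_ge hr hr1 (ha.le.trans (min_le_right _ _))) (abs_nonneg _)
  refine ⟨|x| + |β| * D, fun r hr hr1 => ?_⟩
  have h1 : r ≤ r ^ a := by
    simpa using Real.rpow_le_rpow_of_exponent_ge hr hr1 (ha.le.trans (min_le_left _ _))
  calc |x * r + β * eta r α| ≤ |x| * r + |β| * |eta r α| := by
        refine (abs_add_le _ _).trans_eq ?_
        rw [abs_mul, abs_mul, abs_of_pos hr]
    _ ≤ |x| * r ^ a + |β| * (D * r ^ a) := by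
        gcongr
        exact hD r hr hr1
    _ = _ := by ring

/-- Since `sin` is 1-Lipschitz, dropping `β η` costs `O(r^α)`; the rest, `sin (x r) - x r`, is
`O(r²)`, hence `O(r^α)` on `(0, 1]`. -/
theorem exists_abs_sin_phase_sub_le (x β : ℝ) {α : ℝ} (h1 : 1 < α) (h2 : α < 2) :
    ∃ C, ∀ r, 0 < r → r ≤ 1 → |Real.sin (x * r + β * eta r α) - x * r| ≤ C * r ^ α := by
  refine ⟨|β| * |Real.tan (Real.pi * α / 2)| + x ^ 2 * 2, fun r hr hr1 => ?_⟩
  have hsq : r ^ 2 ≤ r ^ α := by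
    rw [← Real.rpow_two]
    exact Real.rpow_le_rpow_of_exponent_ge hr hr1 h2.le
  have e1 := Real.abs_sin_sub_sin_le (x * r + β * eta r α) (x * r)
  rw [add_sub_cancel_left, abs_mul, abs_eta_of_ne_one h1.ne' hr] at e1
  have e2 := abs_self_sub_sin_le (x * r)
  rw [abs_sub_comm] at e2
  calc _ ≤ |Real.sin (x * r + β * eta r α) - Real.sin (x * r)| + |Real.sin (x * r) - x * r| :=
        abs_sub_le _ _ _
    _ ≤ |β| * (|Real.tan (Real.pi * α / 2)| * r ^ α) + (x * r) ^ 2 * 2 := add_le_add e1 e2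
    _ ≤ |β| * (|Real.tan (Real.pi * α / 2)| * r ^ α) + x ^ 2 * 2 * r ^ α := by
        have := mul_le_mul_of_nonneg_left hsq (by positivity : 0 ≤ x ^ 2 * 2)
        nlinarith
    _ = _ := by ring

/-- Integrability of `F r * r ^ (-p - 1) * exp (-r ^ α)` for `F` of at most linear growth which
vanishes to order `b > p` at the origin. -/
theorem integrableOn_mul_rpow_mul_exp {F : ℝ → ℝ} {α p b C D : ℝ} (hF : Measurable F) (hα : 0 < α)
    (hp : 0 ≤ p) (hb : p < b) (h0 : ∀ r, 0 < r → r ≤ 1 → |F r| ≤ C * r ^ b)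
    (h1 : ∀ r, 1 < r → |F r| ≤ D * r) :
    IntegrableOn (fun r => F r * r ^ (-p - 1) * Real.exp (-r ^ α)) (Ioi 0) := by
  refine integrableOn_Ioi_zero_of_bounds (C := C) (a := b - p - 1)
    (h := fun r => D * (r ^ (1 : ℝ) * Real.exp (-r ^ α))) (by fun_prop) (by linarith) ?_ ?_ ?_
  · intro r hr hr1
    have hr' := Real.rpow_pos_of_pos hr α
    have he : Real.exp (-r ^ α) ≤ 1 := Real.exp_le_one_iff.2 (by linarith)
    have : r ^ (b - p - 1) = r ^ b * r ^ (-p - 1) := by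
      rw [← Real.rpow_add hr]; ring_nf
    rw [abs_mul, abs_mul, Real.abs_exp, abs_of_pos (Real.rpow_pos_of_pos hr _), this, ← mul_assoc]
    refine (mul_le_of_le_one_right (by positivity) he).trans ?_
    gcongr
    exact h0 r hr hr1
  · exact ((integrableOn_rpow_mul_exp_neg_rpow (by norm_num) hα).mono_set
      (Ioi_subset_Ioi zero_le_one)).const_mul D
  · intro r hr
    have hr0 : 0 < r := by linarith
    have hle : r ^ (-p - 1) ≤ 1 := Real.rpow_le_one_of_one_le_of_nonpos hr.le (by linarith)
    rw [abs_mul, abs_mul, Real.abs_exp, abs_of_pos (Real.rpow_pos_of_pos hr0 _), Real.rpow_one,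
      ← mul_assoc]
    exact mul_le_mul_of_nonneg_right
      ((mul_le_of_le_one_right (abs_nonneg _) hle).trans (h1 r hr)) (Real.exp_pos _).le

theorem gIntegrand_neg {p : ℝ} (hp : 0 ≤ p) (x α β : ℝ) :
    gIntegrand (-p) x α β =
      fun r => (Real.cos (x * r + β * eta r α) - 1) * r ^ (-p - 1) * Real.exp (-r ^ α) := by
  ext r
  rw [gIntegrand, if_neg (by linarith)]

theorem gtIntegrand_neg_of_lt {p α : ℝ} (hp : p < min 1 α) (x β : ℝ) :
    gtIntegrand (-p) x α β =
      fun r => Real.sin (x * r + β * eta r α) * r ^ (-p - 1) * Real.exp (-r ^ α) := by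
  ext r
  rw [gtIntegrand, if_pos (by linarith)]

theorem gtIntegrand_neg_of_ge {p α : ℝ} (hp : min 1 α ≤ p) (x β : ℝ) :
    gtIntegrand (-p) x α β =
      fun r => (Real.sin (x * r + β * eta r α) - x * r) * r ^ (-p - 1) * Real.exp (-r ^ α) := by
  ext r
  rw [gtIntegrand, if_neg (by linarith)]

theorem integrableOn_gIntegrand (x β : ℝ) {α p : ℝ} (hα : 0 < α) (hα₂ : α < 2) (hp : 0 ≤ p)
    (hpα : p < α) : IntegrableOn (gIntegrand (-p) x α β) (Ioi 0) := by
  rw [gIntegrand_neg hp]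
  -- `cos - 1` is quadratic in the phase, so it vanishes to order `2 a > p`. Such an `a` exists
  -- because `p < α < 2`.
  obtain ⟨a, ha, ha'⟩ : ∃ a, p / 2 < a ∧ a < min 1 α :=
    exists_between (lt_min (by linarith) (by linarith))
  obtain ⟨C, hC⟩ := exists_abs_phase_le x β ha'
  refine integrableOn_mul_rpow_mul_exp (b := 2 * a) (C := C ^ 2) (D := 2)
    ((Real.measurable_cos.comp (measurable_phase x α β)).sub_const 1) hα hp (by linarith) ?_ ?_
  · intro r hr hr1
    have h := hC r hr hr1
    have hcos := Real.one_sub_sq_div_two_le_cos (x := x * r + β * eta r α)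
    have hle := Real.cos_le_one (x * r + β * eta r α)
    have hsq := pow_le_pow_left₀ (abs_nonneg _) h 2
    rw [sq_abs] at hsq
    have e : C ^ 2 * r ^ (2 * a) = (C * r ^ a) ^ 2 := by
      rw [mul_pow, mul_comm 2 a, Real.rpow_mul hr.le, Real.rpow_two]
    rw [e, abs_of_nonpos (by linarith)]
    nlinarith [sq_nonneg (x * r + β * eta r α)]
  · intro r hr
    rw [abs_of_nonpos (by linarith [Real.cos_le_one (x * r + β * eta r α)])]
    linarith [Real.neg_one_le_cos (x * r + β * eta r α)]

theorem integrableOn_gtIntegrand (x β : ℝ) {α p : ℝ} (hα : 0 < α) (hα₂ : α < 2) (hp : 0 ≤ p)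
    (hpα : p < α) : IntegrableOn (gtIntegrand (-p) x α β) (Ioi 0) := by
  have hms := Real.measurable_sin.comp (measurable_phase x α β)
  rcases lt_or_ge p (min 1 α) with hlt | hge
  · rw [gtIntegrand_neg_of_lt hlt]
    obtain ⟨a, ha, ha'⟩ := exists_between hlt
    obtain ⟨C, hC⟩ := exists_abs_phase_le x β ha'
    refine integrableOn_mul_rpow_mul_exp (b := a) (C := C) (D := 1) hms hα hp ha ?_ ?_
    · exact fun r hr hr1 => Real.abs_sin_le_abs.trans (hC r hr hr1)
    · exact fun r hr => (Real.abs_sin_le_one _).trans (by linarith)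
  · rw [gtIntegrand_neg_of_ge hge]
    -- With `p < α`, the compensated branch `min 1 α ≤ p` can only occur for `α > 1`.
    have h1 : 1 < α := by
      rcases min_le_iff.1 hge with h | h <;> linarith
    obtain ⟨C, hC⟩ := exists_abs_sin_phase_sub_le x β h1 hα₂
    refine integrableOn_mul_rpow_mul_exp (b := α) (C := C) (D := 1 + |x|)
      (hms.sub (measurable_id.const_mul x)) hα hp hpα hC ?_
    intro r hr
    refine (abs_sub _ _).trans ?_
    rw [abs_mul x r, abs_of_pos (by linarith : 0 < r)]
    linarith [Real.abs_sin_le_one (x * r + β * eta r α)]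

/-! ### Moments of a law from its cosine and sine transforms -/

theorem integrableOn_and_integral_comp_mul_rpow_of_pos {k : ℝ → ℝ} {p y : ℝ} (hy : 0 < y)
    (hk : IntegrableOn (fun r => k r * r ^ (-p - 1)) (Ioi 0)) :
    IntegrableOn (fun r => k (r * y) * r ^ (-p - 1)) (Ioi 0) ∧
    ∫ r in Ioi (0 : ℝ), k (r * y) * r ^ (-p - 1) =
      y ^ p * ∫ r in Ioi (0 : ℝ), k r * r ^ (-p - 1) := by
  have e : ∀ r ∈ Ioi (0 : ℝ), y ^ (p + 1) * (k (y * r) * (y * r) ^ (-p - 1)) =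
      k (r * y) * r ^ (-p - 1) := by
    intro r hr
    rw [Real.mul_rpow hy.le (le_of_lt hr), mul_comm y r]
    have : y ^ (p + 1) * y ^ (-p - 1) = 1 := by
      rw [← Real.rpow_add hy]; ring_nf; simp
    linear_combination k (r * y) * r ^ (-p - 1) * this
  have hint : IntegrableOn (fun r => k (y * r) * (y * r) ^ (-p - 1)) (Ioi 0) := by
    have := (integrableOn_Ioi_comp_mul_left_iff (fun r => k r * r ^ (-p - 1)) 0 hy).2
      (by simpa using hk)
    exact this
  refine ⟨IntegrableOn.congr_fun (hint.const_mul (y ^ (p + 1))) e measurableSet_Ioi, ?_⟩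
  rw [← setIntegral_congr_fun measurableSet_Ioi e, integral_const_mul,
    integral_comp_mul_left_Ioi (fun r => k r * r ^ (-p - 1)) 0 hy, mul_zero, smul_eq_mul,
    ← mul_assoc, Real.rpow_add hy, Real.rpow_one, mul_assoc (y ^ p), mul_inv_cancel₀ hy.ne',
    mul_one]

/-- Homogeneity: the weighted integral of an even (`ε = 1`) or odd (`ε = -1`) kernel represents
the combination `y₊ ^ p + ε y₋ ^ p`. -/
theorem integrableOn_and_integral_comp_mul_rpow {k : ℝ → ℝ} {p ε : ℝ} (hp : 0 < p) (h0 : k 0 = 0)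
    (hε : ∀ s, k (-s) = ε * k s)
    (hk : IntegrableOn (fun r => k r * r ^ (-p - 1)) (Ioi 0)) (y : ℝ) :
    IntegrableOn (fun r => k (r * y) * r ^ (-p - 1)) (Ioi 0) ∧
    ∫ r in Ioi (0 : ℝ), k (r * y) * r ^ (-p - 1) =
      (y⁺ ^ p + ε * y⁻ ^ p) * ∫ r in Ioi (0 : ℝ), k r * r ^ (-p - 1) := by
  rcases lt_trichotomy y 0 with hy | rfl | hy
  · have h := integrableOn_and_integral_comp_mul_rpow_of_pos (y := -y) (by linarith) hk
    have e : (fun r => k (r * y) * r ^ (-p - 1)) =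
        fun r => ε * (k (r * -y) * r ^ (-p - 1)) := by
      ext r
      rw [← mul_assoc, ← hε, mul_neg, neg_neg]
    rw [e, integral_const_mul, h.2, posPart_of_nonpos hy.le, negPart_of_nonpos hy.le,
      Real.zero_rpow hp.ne']
    exact ⟨h.1.const_mul ε, by ring⟩
  · simp [h0, Real.zero_rpow hp.ne']
  · have h := integrableOn_and_integral_comp_mul_rpow_of_pos hy hk
    rw [posPart_of_nonneg hy.le, negPart_of_nonneg hy.le, Real.zero_rpow hp.ne']
    exact ⟨h.1, by rw [h.2]; ring⟩

theorem measurable_uncurry_kernel {k : ℝ → ℝ} (hm : Measurable k) (p : ℝ) :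
    Measurable (Function.uncurry fun y r : ℝ => k (r * y) * r ^ (-p - 1)) := by
  unfold Function.uncurry
  fun_prop

/-- Homogeneity of the kernel followed by Fubini. Absolute convergence is the same homogeneity
applied to `|k|`, which is even because `|ε| = 1`. -/
theorem integral_parts_mul_eq_integral_kernel {ν : Measure ℝ} [IsProbabilityMeasure ν] {k : ℝ → ℝ}
    {p ε : ℝ} (hp : 0 < p) (hm : Measurable k) (h0 : k 0 = 0) (hε : ∀ s, k (-s) = ε * k s)
    (hε1 : |ε| = 1) (hk : IntegrableOn (fun r => k r * r ^ (-p - 1)) (Ioi 0))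
    (hpos : Integrable (fun y : ℝ => y⁺ ^ p) ν) (hneg : Integrable (fun y : ℝ => y⁻ ^ p) ν) :
    ((∫ y, y⁺ ^ p ∂ν) + ε * ∫ y, y⁻ ^ p ∂ν) * (∫ r in Ioi (0 : ℝ), k r * r ^ (-p - 1)) =
      ∫ r in Ioi (0 : ℝ), (∫ y, k (r * y) ∂ν) * r ^ (-p - 1) := by
  have hprod : Integrable (Function.uncurry fun y r : ℝ => k (r * y) * r ^ (-p - 1))
      (ν.prod (volume.restrict (Ioi 0))) := by
    rw [integrable_prod_iff (measurable_uncurry_kernel hm p).aestronglyMeasurable]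
    refine ⟨Eventually.of_forall fun y =>
      (integrableOn_and_integral_comp_mul_rpow hp h0 hε hk y).1, ?_⟩
    have habs : IntegrableOn (fun r => |k r| * r ^ (-p - 1)) (Ioi 0) := by
      refine IntegrableOn.congr_fun hk.norm (fun r hr => ?_) measurableSet_Ioi
      simp only [Real.norm_eq_abs, abs_mul]
      rw [abs_of_pos (Real.rpow_pos_of_pos hr _)]
    have hscale := fun y => (integrableOn_and_integral_comp_mul_rpow (k := fun s => |k s|) (ε := 1)
      hp (by simp [h0]) (fun s => by simp [hε, abs_mul, hε1]) habs y).2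
    have e : (fun y => ∫ r in Ioi (0 : ℝ), ‖Function.uncurry
        (fun y r : ℝ => k (r * y) * r ^ (-p - 1)) (y, r)‖) =
        fun y => (y⁺ ^ p + 1 * y⁻ ^ p) * ∫ r in Ioi (0 : ℝ), |k r| * r ^ (-p - 1) := by
      ext y
      rw [← hscale y]
      refine setIntegral_congr_fun measurableSet_Ioi fun r hr => ?_
      simp only [Function.uncurry, Real.norm_eq_abs, abs_mul]
      rw [abs_of_pos (Real.rpow_pos_of_pos hr _)]
    rw [e]
    exact (hpos.add (hneg.const_mul 1)).mul_const _
  have hswap := integral_integral_swap hprod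
  simp only [integral_mul_const] at hswap
  have hadd : (∫ y, y⁺ ^ p ∂ν) + ε * ∫ y, y⁻ ^ p ∂ν = ∫ y, (y⁺ ^ p + ε * y⁻ ^ p) ∂ν := by
    rw [← integral_const_mul, ← integral_add hpos (hneg.const_mul ε)]
  rw [← hswap, hadd, ← integral_mul_const]
  congr 1
  ext y
  exact (integrableOn_and_integral_comp_mul_rpow hp h0 hε hk y).2.symm

theorem gamma_add_one_pos {p : ℝ} (hp : 0 < p) : 0 < Real.Gamma (p + 1) :=
  Real.Gamma_pos_of_pos (by linarith)

/-- The truncated `p`-th moments are finite as soon as `(1 - Re φ(r)) r ^ (-p - 1)` is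
integrable. -/
theorem integrable_parts_of_integrableOn {ν : Measure ℝ} [IsProbabilityMeasure ν]
    {p : ℝ} (hp : 0 < p) (hp2 : p < 2)
    (h : IntegrableOn (fun r => (1 - ∫ y, Real.cos (r * y) ∂ν) * r ^ (-p - 1)) (Ioi 0)) :
    Integrable (fun y : ℝ => y⁺ ^ p) ν ∧ Integrable (fun y : ℝ => y⁻ ^ p) ν := by
  have hm : Measurable fun s => 1 - Real.cos s := by fun_prop
  have hc : ∀ r : ℝ, Integrable (fun y => Real.cos (r * y)) ν := fun r =>
    Integrable.of_bound (by fun_prop) 1 (Eventually.of_forall fun y => Real.abs_cos_le_one _)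
  have hprod : Integrable (Function.uncurry fun y r : ℝ => (1 - Real.cos (r * y)) * r ^ (-p - 1))
      (ν.prod (volume.restrict (Ioi 0))) := by
    -- The integrand is nonnegative for `r > 0`, so product integrability can be tested by
    -- integrating over `y` first, where it is exactly `h`. The other marginal is then integrable,
    -- and it is a nonzero constant times `y⁺ ^ p + y⁻ ^ p`.
    rw [integrable_prod_iff' (measurable_uncurry_kernel hm p).aestronglyMeasurable]
    have hsub : ∀ r : ℝ, Integrable (fun y => 1 - Real.cos (r * y)) ν := fun r =>
      (integrable_const 1).sub (hc r)
    refine ⟨Eventually.of_forall fun r => (hsub r).mul_const (r ^ (-p - 1)), ?_⟩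
    refine h.congr_fun (fun r hr => ?_) measurableSet_Ioi
    have hr' : (0 : ℝ) < r := hr
    have e : (fun y => ‖Function.uncurry (fun y r : ℝ =>
        (1 - Real.cos (r * y)) * r ^ (-p - 1)) (y, r)‖) =
        fun y => (1 - Real.cos (r * y)) * r ^ (-p - 1) := by
      ext y
      simp only [Function.uncurry]
      rw [Real.norm_of_nonneg]
      exact mul_nonneg (by linarith [Real.cos_le_one (r * y)]) (by positivity)
    simp only [e]
    rw [integral_mul_const, integral_sub (integrable_const 1) (hc r)]
    simp
  have hi := hprod.integral_prod_left
  have hK := integral_one_sub_cos_mul_rpow hp hp2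
  have hK0 : (∫ r in Ioi (0 : ℝ), (1 - Real.cos r) * r ^ (-p - 1)) ≠ 0 := by
    intro h0
    rw [h0, zero_mul] at hK
    have hs : 0 < Real.sin (Real.pi * p / 2) :=
      Real.sin_pos_of_pos_of_lt_pi (by have := Real.pi_pos; positivity)
        (by nlinarith [Real.pi_pos])
    have := Real.pi_pos
    have : 0 < Real.pi / (2 * Real.sin (Real.pi * p / 2)) := by positivity
    linarith
  have hscale := fun y => (integrableOn_and_integral_comp_mul_rpow (k := fun s => 1 - Real.cos s)
    (ε := 1) hp (by simp) (fun s => by simp) (integrableOn_one_sub_cos_mul_rpow hp hp2) y).2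
  simp only [Function.uncurry, hscale, one_mul] at hi
  rw [integrable_mul_const_iff (IsUnit.mk0 _ hK0)] at hi
  constructor
  · refine hi.mono' (by fun_prop (disch := exact hp.le)) (Eventually.of_forall fun y => ?_)
    have h1 : 0 ≤ y⁺ ^ p := Real.rpow_nonneg (posPart_nonneg y) p
    have h2 : 0 ≤ y⁻ ^ p := Real.rpow_nonneg (negPart_nonneg y) p
    rw [Real.norm_of_nonneg h1]
    linarith
  · refine hi.mono' (by fun_prop (disch := exact hp.le)) (Eventually.of_forall fun y => ?_)
    have h1 : 0 ≤ y⁺ ^ p := Real.rpow_nonneg (posPart_nonneg y) p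
    have h2 : 0 ≤ y⁻ ^ p := Real.rpow_nonneg (negPart_nonneg y) p
    rw [Real.norm_of_nonneg h2]
    linarith

/-! ### Absolute and signed moments of the standardized law -/

/-- `ν` is a probability measure with characteristic function
`exp (-r ^ α - i (x r + β η(r, α)))` on the positive half-line: the law of a standardized stable
variable with shift `-x`. -/
structure IsStandardLaw (x α β : ℝ) (ν : Measure ℝ) : Prop where
  isProbabilityMeasure : IsProbabilityMeasure ν
  integral_cos : ∀ r, 0 < r →
    ∫ y, Real.cos (r * y) ∂ν = Real.cos (x * r + β * eta r α) * Real.exp (-r ^ α)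
  integral_sin : ∀ r, 0 < r →
    ∫ y, Real.sin (r * y) ∂ν = -(Real.sin (x * r + β * eta r α) * Real.exp (-r ^ α))

namespace IsStandardLaw

variable {x α β p : ℝ} {ν : Measure ℝ}

/-- This splitting separates the part free of `x` and `β`, which integrates to the Gamma term, from
the integrand of `g`. -/
theorem one_sub_integral_cos (hν : IsStandardLaw x α β ν) (hp : 0 ≤ p) {r : ℝ} (hr : 0 < r) :
    (1 - ∫ y, Real.cos (r * y) ∂ν) * r ^ (-p - 1) =
      (1 - Real.exp (-r ^ α)) * r ^ (-p - 1) - gIntegrand (-p) x α β r := by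
  rw [hν.integral_cos r hr, gIntegrand_neg hp]
  ring

theorem integrable_parts (hν : IsStandardLaw x α β ν) (hα₂ : α < 2) (hp : 0 < p) (hpα : p < α) :
    Integrable (fun y : ℝ => y⁺ ^ p) ν ∧ Integrable (fun y : ℝ => y⁻ ^ p) ν := by
  have := hν.isProbabilityMeasure
  refine integrable_parts_of_integrableOn hp (hpα.trans hα₂) ?_
  have h : IntegrableOn (fun r => (1 - Real.exp (-r ^ α)) * r ^ (-p - 1) -
      gIntegrand (-p) x α β r) (Ioi 0) := (integrableOn_one_sub_exp_mul_rpow hp hpα).sub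
    (integrableOn_gIntegrand x β (hp.trans hpα) hα₂ hp.le hpα)
  exact h.congr_fun (fun r hr => (hν.one_sub_integral_cos hp.le hr).symm) measurableSet_Ioi

theorem absolute_moment (hν : IsStandardLaw x α β ν) (hα₂ : α < 2) (hp : 0 < p) (hpα : p < α) :
    (∫ y, y⁺ ^ p ∂ν) + ∫ y, y⁻ ^ p ∂ν =
      2 * Real.sin (Real.pi * p / 2) * Real.Gamma (p + 1) / Real.pi *
        (Real.Gamma (1 - p / α) / p - g (-p) x α β) := by
  have := hν.isProbabilityMeasure
  have hp2 := hpα.trans hα₂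
  obtain ⟨hpos, hneg⟩ := hν.integrable_parts hα₂ hp hpα
  have key := integral_parts_mul_eq_integral_kernel (k := fun s => 1 - Real.cos s) (ε := 1) hp
    (by fun_prop) (by simp) (fun s => by simp) (by simp)
    (integrableOn_one_sub_cos_mul_rpow hp hp2) hpos hneg
  have hc : ∀ r : ℝ, Integrable (fun y => Real.cos (r * y)) ν := fun r =>
    Integrable.of_bound (by fun_prop) 1 (Eventually.of_forall fun y => Real.abs_cos_le_one _)
  have e : ∀ r ∈ Ioi (0 : ℝ), (∫ y, 1 - Real.cos (r * y) ∂ν) * r ^ (-p - 1) =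
      (1 - Real.exp (-r ^ α)) * r ^ (-p - 1) - gIntegrand (-p) x α β r := by
    intro r hr
    rw [integral_sub (integrable_const 1) (hc r), ← hν.one_sub_integral_cos hp.le hr]
    simp
  rw [setIntegral_congr_fun measurableSet_Ioi e, integral_sub
    (integrableOn_one_sub_exp_mul_rpow hp hpα)
    (integrableOn_gIntegrand x β (hp.trans hpα) hα₂ hp.le hpα),
    integral_one_sub_exp_mul_rpow hp hpα, one_mul] at key
  have hK := integral_one_sub_cos_mul_rpow hp hp2
  have hs : 0 < Real.sin (Real.pi * p / 2) :=
    Real.sin_pos_of_pos_of_lt_pi (by have := Real.pi_pos; positivity) (by nlinarith [Real.pi_pos])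
  have hG := gamma_add_one_pos hp
  have hpi := Real.pi_pos
  rw [eq_div_iff (by positivity)] at hK
  rw [g, ← key]
  field_simp
  linear_combination (-((∫ y, y⁺ ^ p ∂ν) + ∫ y, y⁻ ^ p ∂ν)) * hK

theorem signed_moment_of_lt (hν : IsStandardLaw x α β ν) (hα₂ : α < 2) (hp : 0 < p)
    (hpα : p < min 1 α) :
    (∫ y, y⁺ ^ p ∂ν) - ∫ y, y⁻ ^ p ∂ν =
      -(2 * Real.cos (Real.pi * p / 2) * Real.Gamma (p + 1) / Real.pi * gt (-p) x α β) := by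
  have := hν.isProbabilityMeasure
  have hp1 : p < 1 := hpα.trans_le (min_le_left _ _)
  have hpα' : p < α := hpα.trans_le (min_le_right _ _)
  obtain ⟨hpos, hneg⟩ := hν.integrable_parts hα₂ hp hpα'
  have key := integral_parts_mul_eq_integral_kernel (k := fun s => Real.sin s) (ε := -1) hp
    (by fun_prop) (by simp) (fun s => by simp) (by simp)
    (integrableOn_sin_mul_rpow hp hp1) hpos hneg
  have e : ∀ r ∈ Ioi (0 : ℝ), (∫ y, Real.sin (r * y) ∂ν) * r ^ (-p - 1) =
      - gtIntegrand (-p) x α β r := by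
    intro r hr
    rw [hν.integral_sin r hr, gtIntegrand_neg_of_lt hpα]
    ring
  rw [setIntegral_congr_fun measurableSet_Ioi e, integral_neg] at key
  have hK := integral_sin_mul_rpow hp hp1
  have hpi := Real.pi_pos
  have hs : 0 < Real.cos (Real.pi * p / 2) :=
    Real.cos_pos_of_mem_Ioo ⟨by nlinarith, by nlinarith⟩
  have hG := gamma_add_one_pos hp
  rw [eq_div_iff (by positivity)] at hK
  rw [gt, ← mul_neg, ← key]
  field_simp
  linear_combination (-((∫ y, y⁺ ^ p ∂ν) - ∫ y, y⁻ ^ p ∂ν)) * hK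

theorem integrable_id (hν : IsStandardLaw x α β ν) (hα₁ : 1 < α) (hα₂ : α < 2) :
    Integrable (fun y : ℝ => y) ν := by
  obtain ⟨hpos, hneg⟩ := hν.integrable_parts hα₂ one_pos hα₁
  refine (hpos.sub hneg).congr (Eventually.of_forall fun y => ?_)
  simp [posPart_sub_negPart]

/-- The limit of `E sin (r Y) / r` as `r → 0+`, computed twice: by domination by `|y|` it is the
mean, and from the explicit sine transform it is `-x`, since the phase term differs from `x r` by
`O(r^α)` with `α > 1`. -/
theorem integral_id (hν : IsStandardLaw x α β ν) (hα₁ : 1 < α) (hα₂ : α < 2) :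
    ∫ y, y ∂ν = -x := by
  have hid := hν.integrable_id hα₁ hα₂
  have hα : 0 < α := by linarith
  have h1 : Tendsto (fun r : ℝ => ∫ y, Real.sin (r * y) / r ∂ν) (𝓝[>] 0) (𝓝 (∫ y, y ∂ν)) := by
    refine tendsto_integral_filter_of_dominated_convergence (fun y => |y|) ?_ ?_ hid.abs ?_
    · exact Eventually.of_forall fun r => by fun_prop
    · filter_upwards [self_mem_nhdsWithin] with r hr
      have hr' : (0 : ℝ) < r := hr
      refine Eventually.of_forall fun y => ?_
      rw [Real.norm_eq_abs, abs_div, abs_of_pos hr', div_le_iff₀ hr']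
      refine Real.abs_sin_le_abs.trans_eq ?_
      rw [abs_mul, abs_of_pos hr', mul_comm]
    · refine Eventually.of_forall fun y => ?_
      have hd : HasDerivAt (fun r : ℝ => Real.sin (r * y)) y 0 := by
        have := ((hasDerivAt_id (0 : ℝ)).mul_const y).sin
        simpa using this
      have := hd.tendsto_slope_zero_right
      refine this.congr fun r => ?_
      simp [div_eq_inv_mul]
  have h2 : Tendsto (fun r : ℝ => ∫ y, Real.sin (r * y) / r ∂ν) (𝓝[>] 0) (𝓝 (-x)) := by
    obtain ⟨C, hC⟩ := exists_abs_sin_phase_sub_le x β hα₁ hα₂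
    have hrem : Tendsto (fun r : ℝ => (Real.sin (x * r + β * eta r α) - x * r) / r)
        (𝓝[>] 0) (𝓝 0) := by
      have hlim : Tendsto (fun r : ℝ => C * r ^ (α - 1)) (𝓝[>] 0) (𝓝 0) := by
        have : Tendsto (fun r : ℝ => C * r ^ (α - 1)) (𝓝 0) (𝓝 (C * (0 : ℝ) ^ (α - 1))) :=
          ((Real.continuousAt_rpow_const 0 (α - 1) (Or.inr (by linarith))).const_mul C)
        rw [Real.zero_rpow (by linarith), mul_zero] at this
        exact this.mono_left nhdsWithin_le_nhds
      refine squeeze_zero_norm' ?_ hlim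
      filter_upwards [Ioc_mem_nhdsGT (zero_lt_one (α := ℝ))] with r hr
      rw [Real.norm_eq_abs, abs_div, abs_of_pos hr.1, div_le_iff₀ hr.1, mul_assoc,
        Real.rpow_sub_one hr.1.ne', div_mul_cancel₀ _ hr.1.ne']
      exact hC r hr.1 hr.2
    have hexp : Tendsto (fun r : ℝ => Real.exp (-r ^ α)) (𝓝[>] 0) (𝓝 1) := by
      have : Tendsto (fun r : ℝ => Real.exp (-r ^ α)) (𝓝 0) (𝓝 (Real.exp (-(0 : ℝ) ^ α))) :=
        ((Real.continuousAt_rpow_const 0 α (Or.inr hα.le)).neg.rexp)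
      rw [Real.zero_rpow hα.ne', neg_zero, Real.exp_zero] at this
      exact this.mono_left nhdsWithin_le_nhds
    have := ((hrem.add_const x).mul hexp).neg
    simp only [zero_add, mul_one] at this
    refine this.congr' ?_
    filter_upwards [self_mem_nhdsWithin] with r hr
    have hr' : (0 : ℝ) < r := hr
    rw [integral_div, hν.integral_sin r hr]
    field_simp
    ring
  exact tendsto_nhds_unique h1 h2

theorem signed_moment_one (hν : IsStandardLaw x α β ν) (hα₁ : 1 < α) (hα₂ : α < 2) :
    (∫ y, y⁺ ^ (1 : ℝ) ∂ν) - ∫ y, y⁻ ^ (1 : ℝ) ∂ν = -x := by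
  obtain ⟨hpos, hneg⟩ := hν.integrable_parts hα₂ one_pos hα₁
  rw [← integral_sub hpos hneg, ← hν.integral_id hα₁ hα₂]
  congr 1
  ext y
  simp [posPart_sub_negPart]

/-- For `p > 1` the kernel `sin r * r^(-p-1)` is not integrable at `0`, so `r - sin r` replaces it;
the linear term contributes the mean `-x`. -/
theorem signed_moment_of_gt (hν : IsStandardLaw x α β ν) (hα₂ : α < 2) (hp : 1 < p)
    (hpα : p < α) :
    (∫ y, y⁺ ^ p ∂ν) - ∫ y, y⁻ ^ p ∂ν =
      2 * Real.cos (Real.pi * p / 2) * Real.Gamma (p + 1) / Real.pi *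
        (-x / α * Real.Gamma ((1 - p) / α) - gt (-p) x α β) := by
  have := hν.isProbabilityMeasure
  have hp0 : 0 < p := by linarith
  have hp2 : p < 2 := hpα.trans hα₂
  have hα₁ : 1 < α := hp.trans hpα
  have hα : 0 < α := by linarith
  obtain ⟨hpos, hneg⟩ := hν.integrable_parts hα₂ hp0 hpα
  have key := integral_parts_mul_eq_integral_kernel (k := fun s => s - Real.sin s) (ε := -1) hp0
    (by fun_prop) (by simp) (fun s => by simp; ring) (by simp)
    (integrableOn_sub_sin_mul_rpow hp hp2) hpos hneg
  have hs : ∀ r : ℝ, Integrable (fun y => Real.sin (r * y)) ν := fun r =>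
    Integrable.of_bound (by fun_prop) 1 (Eventually.of_forall fun y => Real.abs_sin_le_one _)
  -- With `e = e^(-r^α)`, `-x r + s e = (s - x r) e - x r (1 - e)`; the extra factor `r` makes the
  -- last term a Gamma term with `q = p - 1`.
  have e : ∀ r ∈ Ioi (0 : ℝ), (∫ y, r * y - Real.sin (r * y) ∂ν) * r ^ (-p - 1) =
      gtIntegrand (-p) x α β r - x * ((1 - Real.exp (-r ^ α)) * r ^ (-(p - 1) - 1)) := by
    intro r hr
    have hr' : (0 : ℝ) < r := hr
    have hpow : r ^ (-(p - 1) - 1) = r * r ^ (-p - 1) := by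
      rw [← Real.rpow_one_add' hr'.le (by linarith)]; ring_nf
    rw [integral_sub ((hν.integrable_id hα₁ hα₂).const_mul r) (hs r), integral_const_mul,
      hν.integral_id hα₁ hα₂, hν.integral_sin r hr, hpow,
      gtIntegrand_neg_of_ge ((min_le_left _ _).trans hp.le)]
    ring
  rw [setIntegral_congr_fun measurableSet_Ioi e, integral_sub
    (integrableOn_gtIntegrand x β hα hα₂ hp0.le hpα)
    ((integrableOn_one_sub_exp_mul_rpow (by linarith) (by linarith)).const_mul x),
    integral_const_mul, integral_one_sub_exp_mul_rpow (by linarith) (by linarith)] at key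
  have hGam : Real.Gamma (1 - (p - 1) / α) = (1 - p) / α * Real.Gamma ((1 - p) / α) := by
    rw [← Real.Gamma_add_one (div_ne_zero (by linarith) hα.ne')]
    congr 1
    ring
  have hK := integral_sub_sin_mul_rpow hp hp2
  have hpi := Real.pi_pos
  have hc : Real.cos (Real.pi * p / 2) < 0 :=
    Real.cos_neg_of_pi_div_two_lt_of_lt (by nlinarith) (by nlinarith)
  have hG := gamma_add_one_pos hp0
  rw [eq_div_iff (by nlinarith)] at hK
  rw [hGam] at key
  have hp1 : p - 1 ≠ 0 := by linarith
  have key' : -x / α * Real.Gamma ((1 - p) / α) - gt (-p) x α β =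
      -(((∫ y, y⁺ ^ p ∂ν) - ∫ y, y⁻ ^ p ∂ν) *
        ∫ r in Ioi (0 : ℝ), (r - Real.sin r) * r ^ (-p - 1)) := by
    rw [sub_eq_add_neg (∫ y, y⁺ ^ p ∂ν), ← neg_one_mul (∫ y, y⁻ ^ p ∂ν), key, gt]
    field_simp
    ring
  rw [key']
  field_simp
  linear_combination (-((∫ y, y⁺ ^ p ∂ν) - ∫ y, y⁻ ^ p ∂ν)) * hK

end IsStandardLaw

/-! ### Continuity of `g` and `gt` as `p → 0+` -/

theorem rpow_le_add_of_between {r a b c : ℝ} (hr : 0 < r) (hab : a ≤ b) (hbc : b ≤ c) :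
    r ^ b ≤ r ^ a + r ^ c := by
  have h1 := Real.rpow_pos_of_pos hr a
  have h2 := Real.rpow_pos_of_pos hr c
  rcases le_total r 1 with h | h
  · linarith [Real.rpow_le_rpow_of_exponent_ge hr h hab]
  · linarith [Real.rpow_le_rpow_of_exponent_le h hbc]

/-- Dominated convergence: for `0 < p ≤ q` the power `r^(-p-1)` is at most the sum of the powers at
the endpoints `0` and `q`. -/
theorem tendsto_integral_mul_rpow_mul_exp {F : ℝ → ℝ} {α q : ℝ} (hF : Measurable F) (hq : 0 < q)
    (h0 : IntegrableOn (fun r => F r * r ^ (-(0 : ℝ) - 1) * Real.exp (-r ^ α)) (Ioi 0))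
    (h1 : IntegrableOn (fun r => F r * r ^ (-q - 1) * Real.exp (-r ^ α)) (Ioi 0)) :
    Tendsto (fun p : ℝ => ∫ r in Ioi (0 : ℝ), F r * r ^ (-p - 1) * Real.exp (-r ^ α)) (𝓝[>] 0)
      (𝓝 (∫ r in Ioi (0 : ℝ), F r * r ^ (-(0 : ℝ) - 1) * Real.exp (-r ^ α))) := by
  refine tendsto_integral_filter_of_dominated_convergence _ ?_ ?_ (h1.norm.add h0.norm) ?_
  · exact Eventually.of_forall fun p => by fun_prop
  · filter_upwards [Ioc_mem_nhdsGT hq] with p hp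
    filter_upwards [ae_restrict_mem measurableSet_Ioi] with r hr
    have hr' : (0 : ℝ) < r := hr
    have hle := rpow_le_add_of_between hr' (a := -q - 1) (b := -p - 1) (c := -0 - 1)
      (by linarith [hp.2]) (by linarith [hp.1])
    simp only [Pi.add_apply, norm_mul, Real.norm_eq_abs, Real.abs_exp,
      abs_of_pos (Real.rpow_pos_of_pos hr' _)]
    rw [← add_mul, ← mul_add]
    gcongr
  · filter_upwards [ae_restrict_mem measurableSet_Ioi] with r hr
    have hr' : (0 : ℝ) < r := hr
    have hc : Continuous fun p : ℝ => F r * r ^ (-p - 1) * Real.exp (-r ^ α) := by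
      have : Continuous fun p : ℝ => r ^ (-p - 1) :=
        continuous_const.rpow (by fun_prop) fun _ => Or.inl hr'.ne'
      fun_prop
    exact (hc.tendsto 0).mono_left nhdsWithin_le_nhds

theorem tendsto_g_neg (x β : ℝ) {α : ℝ} (hα : 0 < α) (hα₂ : α < 2) :
    Tendsto (fun p => g (-p) x α β) (𝓝[>] 0) (𝓝 (g 0 x α β)) := by
  have hI := integrableOn_gIntegrand x β hα hα₂ le_rfl hα
  have hJ := integrableOn_gIntegrand x β hα hα₂ (half_pos hα).le (half_lt_self hα)
  rw [gIntegrand_neg le_rfl] at hI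
  rw [gIntegrand_neg (half_pos hα).le] at hJ
  have h := tendsto_integral_mul_rpow_mul_exp
    ((Real.measurable_cos.comp (measurable_phase x α β)).sub_const 1) (half_pos hα) hI hJ
  have e0 : g 0 x α β = ∫ r in Ioi (0 : ℝ),
      (Real.cos (x * r + β * eta r α) - 1) * r ^ (-(0 : ℝ) - 1) * Real.exp (-r ^ α) := by
    rw [← gIntegrand_neg le_rfl, neg_zero, g]
  rw [e0]
  refine h.congr' ?_
  filter_upwards [self_mem_nhdsWithin] with p hp
  rw [g, gIntegrand_neg (le_of_lt hp)]
  rfl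

theorem tendsto_gt_neg (x β : ℝ) {α : ℝ} (hα : 0 < α) (hα₂ : α < 2) :
    Tendsto (fun p => gt (-p) x α β) (𝓝[>] 0) (𝓝 (gt 0 x α β)) := by
  have hmin : 0 < min 1 α := lt_min one_pos hα
  obtain ⟨q, hq0, hq⟩ := exists_between hmin
  have hI := integrableOn_gtIntegrand x β hα hα₂ le_rfl hα
  have hJ := integrableOn_gtIntegrand x β hα hα₂ hq0.le (hq.trans_le (min_le_right _ _))
  rw [gtIntegrand_neg_of_lt hmin] at hI
  rw [gtIntegrand_neg_of_lt hq] at hJ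
  have h := tendsto_integral_mul_rpow_mul_exp
    (Real.measurable_sin.comp (measurable_phase x α β)) hq0 hI hJ
  have e0 : gt 0 x α β = ∫ r in Ioi (0 : ℝ),
      Real.sin (x * r + β * eta r α) * r ^ (-(0 : ℝ) - 1) * Real.exp (-r ^ α) := by
    rw [← gtIntegrand_neg_of_lt hmin, neg_zero, gt]
  rw [e0]
  refine h.congr' ?_
  filter_upwards [Ioo_mem_nhdsGT hmin] with p hp
  rw [gt, gtIntegrand_neg_of_lt hp.2]
  rfl

/-! ### Positive-part moments of the standardized law -/

namespace IsStandardLaw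

variable {x α β p : ℝ} {ν : Measure ℝ}

theorem positive_moment_of_lt (hν : IsStandardLaw x α β ν) (hα₂ : α < 2) (hp : 0 < p)
    (hpα : p < min 1 α) :
    ∫ y, y⁺ ^ p ∂ν = Real.Gamma (p + 1) / Real.pi *
      (Real.sin (Real.pi * p / 2) * (Real.Gamma (1 - p / α) / p - g (-p) x α β)
        - Real.cos (Real.pi * p / 2) * gt (-p) x α β) := by
  have h1 := hν.absolute_moment hα₂ hp (hpα.trans_le (min_le_right _ _))
  have h2 := hν.signed_moment_of_lt hα₂ hp hpα
  linear_combination (1 / 2) * h1 + (1 / 2) * h2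

theorem positive_moment_one (hν : IsStandardLaw x α β ν) (hα₁ : 1 < α) (hα₂ : α < 2) :
    ∫ y, y⁺ ^ (1 : ℝ) ∂ν =
      -x / 2 + 1 / Real.pi * (Real.Gamma (1 - 1 / α) - g (-1) x α β) := by
  have h1 := hν.absolute_moment hα₂ one_pos hα₁
  have h2 := hν.signed_moment_one hα₁ hα₂
  rw [mul_one, Real.sin_pi_div_two, one_add_one_eq_two, Real.Gamma_two, div_one] at h1
  linear_combination (1 / 2) * h1 + (1 / 2) * h2

theorem positive_moment_of_gt (hν : IsStandardLaw x α β ν) (hα₂ : α < 2) (hp : 1 < p)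
    (hpα : p < α) :
    ∫ y, y⁺ ^ p ∂ν = Real.Gamma (p + 1) / Real.pi *
      (Real.sin (Real.pi * p / 2) * (Real.Gamma (1 - p / α) / p - g (-p) x α β)
        + Real.cos (Real.pi * p / 2) *
          (-x / α * Real.Gamma ((1 - p) / α) - gt (-p) x α β)) := by
  have h1 := hν.absolute_moment hα₂ (by linarith) hpα
  have h2 := hν.signed_moment_of_gt hα₂ hp hpα
  linear_combination (1 / 2) * h1 + (1 / 2) * h2

/-- Along `p > 0` one has `0 ^ p = 0`, so the pointwise limit is the indicator of the open
half-line. The dominating function is `1 + y⁺ ^ (α/2)`. -/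
theorem tendsto_positive_moment (hν : IsStandardLaw x α β ν) (hα : 0 < α) (hα₂ : α < 2) :
    Tendsto (fun p : ℝ => ∫ y, y⁺ ^ p ∂ν) (𝓝[>] 0) (𝓝 (ν.real (Ioi 0))) := by
  have := hν.isProbabilityMeasure
  rw [← integral_indicator_one measurableSet_Ioi]
  obtain ⟨hpos, -⟩ := hν.integrable_parts hα₂ (half_pos hα) (half_lt_self hα)
  refine tendsto_integral_filter_of_dominated_convergence _ ?_ ?_
    ((integrable_const (1 : ℝ)).add hpos) ?_
  · filter_upwards [self_mem_nhdsWithin] with p hp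
    fun_prop (disch := exact le_of_lt hp)
  · filter_upwards [Ioc_mem_nhdsGT (half_pos hα)] with p hp
    refine Eventually.of_forall fun y => ?_
    simp only [Pi.add_apply]
    rw [Real.norm_of_nonneg (Real.rpow_nonneg (posPart_nonneg y) p)]
    rcases (posPart_nonneg y).eq_or_lt with h | h
    · rw [← h, Real.zero_rpow hp.1.ne']
      have := Real.rpow_nonneg (le_refl (0 : ℝ)) (α / 2)
      linarith
    · have := rpow_le_add_of_between h hp.1.le hp.2
      rwa [Real.rpow_zero] at this
  · refine Eventually.of_forall fun y => ?_
    rcases le_or_gt y 0 with h | h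
    · rw [indicator_of_notMem (by simpa using h), posPart_of_nonpos h]
      refine tendsto_const_nhds.congr' ?_
      filter_upwards [self_mem_nhdsWithin] with p hp
      rw [Real.zero_rpow (ne_of_gt hp)]
    · rw [indicator_of_mem (by simpa using h), posPart_of_nonneg h.le]
      have hc : Continuous fun p : ℝ => y ^ p :=
        continuous_const.rpow continuous_id fun _ => Or.inl h.ne'
      have := (hc.tendsto 0).mono_left (nhdsWithin_le_nhds (s := Ioi 0))
      simpa using this

/-- The limit `p → 0+` of `positive_moment_of_lt`; the `1 / 2` is `(1/π)` times `lim sin (π p / 2) /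
p = π / 2`. -/
theorem measure_Ioi_zero (hν : IsStandardLaw x α β ν) (hα : 0 < α) (hα₂ : α < 2) :
    ν.real (Ioi 0) = 1 / 2 - 1 / Real.pi * gt 0 x α β := by
  have hpi := Real.pi_pos
  have hG : ∀ {f : ℝ → ℝ}, Continuous f → f 0 = 1 →
      Tendsto (fun p => Real.Gamma (f p)) (𝓝[>] 0) (𝓝 1) := by
    intro f hf h1
    have hd : ContinuousAt Real.Gamma (f 0) := by
      rw [h1]
      refine (Real.differentiableAt_Gamma fun m => ?_).continuousAt
      have : (0 : ℝ) ≤ m := m.cast_nonneg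
      intro h
      linarith
    have := (hd.comp hf.continuousAt).tendsto
    simp only [Function.comp_apply, h1, Real.Gamma_one] at this
    exact this.mono_left nhdsWithin_le_nhds
  have hsin : Tendsto (fun p : ℝ => Real.sin (Real.pi * p / 2) / p) (𝓝[>] 0) (𝓝 (Real.pi / 2)) := by
    have hd : HasDerivAt (fun p : ℝ => Real.sin (Real.pi * p / 2)) (Real.pi / 2) 0 := by
      have := (((hasDerivAt_id (0 : ℝ)).const_mul Real.pi).div_const 2).sin
      simpa using this
    refine hd.tendsto_slope_zero_right.congr fun p => ?_
    simp [div_eq_inv_mul]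
  have hcos : Tendsto (fun p : ℝ => Real.cos (Real.pi * p / 2)) (𝓝[>] 0) (𝓝 1) := by
    have : Continuous fun p : ℝ => Real.cos (Real.pi * p / 2) := by fun_prop
    simpa using (this.tendsto 0).mono_left (nhdsWithin_le_nhds (s := Ioi 0))
  have hid : Tendsto (fun p : ℝ => p) (𝓝[>] 0) (𝓝 0) := nhdsWithin_le_nhds
  -- The singular `1 / p` is moved onto the sine: `sin (π p / 2) / p * (Γ(1 - p/α) - p g)`.
  have hlim := ((hG (f := fun p => p + 1) (by fun_prop) (by simp)).div_const Real.pi).mul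
    ((hsin.mul ((hG (f := fun p => 1 - p / α) (by fun_prop) (by simp)).sub
      (hid.mul (tendsto_g_neg x β hα hα₂)))).sub (hcos.mul (tendsto_gt_neg x β hα hα₂)))
  have heq := tendsto_nhds_unique (hν.tendsto_positive_moment hα hα₂) (hlim.congr' ?_)
  · rw [heq]
    field_simp
    ring
  · filter_upwards [Ioo_mem_nhdsGT (lt_min one_pos hα)] with p hp
    rw [hν.positive_moment_of_lt hα₂ hp.1 hp.2]
    have := hp.1.ne'
    field_simp

end IsStandardLaw

/-! ### Reflection, standardization and the passage from `ν` to `X` -/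

theorem eta_neg (u α : ℝ) : eta (-u) α = -eta u α := by
  unfold eta
  split_ifs
  · rw [abs_neg]; ring
  · rw [abs_neg, Real.sign_neg]; ring

theorem stableCF_neg (α β γ δ u : ℝ) : stableCF α β γ δ (-u) = stableCF α (-β) γ (-δ) u := by
  unfold stableCF
  rw [eta_neg, abs_neg]
  push_cast
  ring_nf

theorem stableCF_exponent (α β γ δ u : ℝ) :
    stableCF α β γ δ u = Complex.exp (((-(γ ^ α * |u| ^ α) : ℝ) : ℂ) +
      ((-(γ ^ α * β * eta u α - u * δ) : ℝ) : ℂ) * Complex.I) := by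
  unfold stableCF
  push_cast
  ring_nf

/-- For `α ≠ 1`, `η` is homogeneous of degree `α` and `γ` cancels. For `α = 1` the logarithm leaves
a term linear in `r`, which is the `log γ` correction in `deltaStar`. -/
theorem exponent_standardize {α γ r : ℝ} (β δ : ℝ) (hγ : 0 < γ) (hr : 0 < r) :
    γ ^ α * |γ⁻¹ * r| ^ α = r ^ α ∧
    γ ^ α * β * eta (γ⁻¹ * r) α - γ⁻¹ * r * δ =
      -deltaStar α β γ δ * r + β * eta r α := by
  have hpow : γ ^ α * |γ⁻¹ * r| ^ α = r ^ α := by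
    rw [abs_of_pos (by positivity), ← Real.mul_rpow hγ.le (by positivity),
      mul_inv_cancel_left₀ hγ.ne']
  refine ⟨hpow, ?_⟩
  by_cases hα : α = 1
  · subst hα
    simp only [eta, deltaStar, if_true, Real.rpow_one]
    rw [abs_of_pos (by positivity), abs_of_pos hr, Real.log_mul (by positivity) hr.ne',
      Real.log_inv]
    have := Real.pi_pos
    field_simp
    ring
  · simp only [eta, deltaStar, if_neg hα]
    rw [Real.sign_of_pos hr, Real.sign_of_pos (by positivity), abs_of_pos hr]
    linear_combination (-(β * Real.tan (Real.pi * α / 2))) * hpow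

theorem integral_cos_sin_eq_charFun (ν : Measure ℝ) [IsProbabilityMeasure ν] (r : ℝ) :
    ∫ y, Real.cos (r * y) ∂ν = (charFun ν r).re ∧ ∫ y, Real.sin (r * y) ∂ν = (charFun ν r).im := by
  have hint : Integrable (fun y : ℝ => Complex.exp (r * y * Complex.I)) ν := by
    refine Integrable.of_bound (by fun_prop) 1 (Eventually.of_forall fun y => ?_)
    rw [← Complex.ofReal_mul, Complex.norm_exp_ofReal_mul_I]
  rw [charFun_apply_real]
  constructor
  · rw [← RCLike.re_eq_complex_re, ← integral_re hint]
    congr 1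
    ext y
    rw [← Complex.ofReal_mul, RCLike.re_eq_complex_re, Complex.exp_ofReal_mul_I_re]
  · rw [← RCLike.im_eq_complex_im, ← integral_im hint]
    congr 1
    ext y
    rw [← Complex.ofReal_mul, RCLike.im_eq_complex_im, Complex.exp_ofReal_mul_I_im]

theorem IsStableLaw.isStandardLaw_map {α β γ δ : ℝ} {μ : Measure ℝ} (h : IsStableLaw α β γ δ μ)
    (hγ : 0 < γ) : IsStandardLaw (-deltaStar α β γ δ) α β (μ.map (γ⁻¹ * ·)) := by
  have := h.isProbabilityMeasure
  have hprob : IsProbabilityMeasure (μ.map (γ⁻¹ * ·)) :=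
    Measure.isProbabilityMeasure_map (by fun_prop)
  have hcf : ∀ r, 0 < r → charFun (μ.map (γ⁻¹ * ·)) r = Complex.exp (((-(r ^ α) : ℝ) : ℂ) +
      ((-(-deltaStar α β γ δ * r + β * eta r α) : ℝ) : ℂ) * Complex.I) := by
    intro r hr
    obtain ⟨h1, h2⟩ := exponent_standardize (α := α) β δ hγ hr
    rw [charFun_map_mul, h.charFun_eq, stableCF_exponent, h1, h2]
  refine ⟨hprob, fun r hr => ?_, fun r hr => ?_⟩
  · rw [(integral_cos_sin_eq_charFun _ r).1, hcf r hr, Complex.exp_add, ← Complex.ofReal_exp,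
      Complex.re_ofReal_mul, Complex.exp_ofReal_mul_I_re, Real.cos_neg, mul_comm]
  · rw [(integral_cos_sin_eq_charFun _ r).2, hcf r hr, Complex.exp_add, ← Complex.ofReal_exp,
      Complex.im_ofReal_mul, Complex.exp_ofReal_mul_I_im, Real.sin_neg]
    ring

theorem measurable_truncPow_posPart (p : ℝ) : Measurable fun y : ℝ => truncPow y⁺ p := by
  have hpos : Measurable fun y : ℝ => y⁺ := by fun_prop
  refine Measurable.ite (hpos (measurableSet_singleton 0)) measurable_const ?_
  exact (hpos.pow_const p).ennreal_ofReal

theorem posMoment_eq_m {Ω : Type*} [MeasurableSpace Ω] {P : Measure Ω} {X : Ω → ℝ} {α β γ δ : ℝ}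
    (hX : IsStable P X α β γ δ) (p : ℝ) : posMoment P X p = m p α β γ δ := by
  rw [m, ← hX.2.eq_stableLaw, posMoment, posMoment,
    lintegral_map' (measurable_truncPow_posPart p).aemeasurable hX.1]

theorem IsStable.neg {Ω : Type*} [MeasurableSpace Ω] {P : Measure Ω} {X : Ω → ℝ} {α β γ δ : ℝ}
    (hX : IsStable P X α β γ δ) : IsStable P (fun ω => -X ω) α (-β) γ (-δ) := by
  have hprob := hX.2.isProbabilityMeasure
  have : IsProbabilityMeasure P := (Measure.isProbabilityMeasure_map_iff hX.1).1 hprob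
  refine ⟨hX.1.neg, Measure.isProbabilityMeasure_map hX.1.neg, fun u => ?_⟩
  have h := charFun_map_mul_comp hX.1 (-1) u
  simp only [neg_one_mul] at h
  rw [h, hX.2.charFun_eq, stableCF_neg]

theorem negMoment_eq_posMoment_neg {Ω : Type*} [MeasurableSpace Ω] (P : Measure Ω) (X : Ω → ℝ)
    (p : ℝ) : negMoment P X p = posMoment P (fun ω => -X ω) p := by
  simp only [negMoment, posMoment, posPart_neg]

/-- The truncated moment of `X` in terms of the law of `X / γ`. -/
theorem IsStableLaw.m_eq_ofReal {α β γ δ p : ℝ} {μ : Measure ℝ} (h : IsStableLaw α β γ δ μ)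
    (hα₂ : α < 2) (hγ : 0 < γ) (hp : 0 < p) (hpα : p < α) :
    m p α β γ δ = ENNReal.ofReal (γ ^ p * ∫ y, y⁺ ^ p ∂(μ.map (γ⁻¹ * ·))) := by
  obtain ⟨hpos, -⟩ := (h.isStandardLaw_map hγ).integrable_parts hα₂ hp hpα
  rw [← integral_const_mul, ofReal_integral_eq_lintegral_ofReal (hpos.const_mul _)
    (Eventually.of_forall fun y => mul_nonneg (Real.rpow_nonneg hγ.le p)
      (Real.rpow_nonneg (posPart_nonneg y) p)),
    lintegral_map (by fun_prop (disch := exact hp.le)) (by fun_prop), m, ← h.eq_stableLaw,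
    posMoment]
  refine lintegral_congr fun x => ?_
  rw [truncPow_of_pos _ hp, ← Real.mul_rpow hγ.le (posPart_nonneg _)]
  congr 2
  rcases le_total x 0 with hx | hx
  · rw [posPart_of_nonpos hx, posPart_of_nonpos
      (mul_nonpos_of_nonneg_of_nonpos (inv_nonneg.2 hγ.le) hx), mul_zero]
  · rw [posPart_of_nonneg hx, posPart_of_nonneg (by positivity), mul_inv_cancel_left₀ hγ.ne']

theorem IsStableLaw.m_toReal {α β γ δ p : ℝ} {μ : Measure ℝ} (h : IsStableLaw α β γ δ μ)
    (hα₂ : α < 2) (hγ : 0 < γ) (hp : 0 < p) (hpα : p < α) :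
    (m p α β γ δ).toReal = γ ^ p * ∫ y, y⁺ ^ p ∂(μ.map (γ⁻¹ * ·)) := by
  rw [h.m_eq_ofReal hα₂ hγ hp hpα, ENNReal.toReal_ofReal]
  exact mul_nonneg (Real.rpow_nonneg hγ.le p)
    (integral_nonneg fun y => Real.rpow_nonneg (posPart_nonneg y) p)

theorem IsStableLaw.m_zero {α β γ δ : ℝ} {μ : Measure ℝ} (h : IsStableLaw α β γ δ μ) :
    m 0 α β γ δ = μ (Ioi 0) := by
  rw [m, ← h.eq_stableLaw, posMoment, ← lintegral_indicator_one measurableSet_Ioi]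
  refine lintegral_congr fun x => ?_
  rcases le_or_gt x 0 with hx | hx
  -- The convention in `truncPow` matters here: the ordinary power `0 ^ 0 = 1` would count the event
  -- `X ≤ 0`.
  · rw [posPart_of_nonpos hx, indicator_of_notMem (by simpa using hx), truncPow, if_pos rfl]
  · rw [posPart_of_nonneg hx.le, indicator_of_mem (by simpa using hx), truncPow, if_neg hx.ne']
    simp

theorem IsStableLaw.m_zero_toReal {α β γ δ : ℝ} {μ : Measure ℝ} (h : IsStableLaw α β γ δ μ)
    (hα : 0 < α) (hα₂ : α < 2) (hγ : 0 < γ) :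
    (m 0 α β γ δ).toReal = 1 / 2 - 1 / Real.pi * gt 0 (-deltaStar α β γ δ) α β := by
  rw [← (h.isStandardLaw_map hγ).measure_Ioi_zero hα hα₂, h.m_zero, measureReal_def,
    Measure.map_apply (by fun_prop) measurableSet_Ioi]
  congr 2
  ext x
  simp [hγ]

end StableMoments

end

theorem theorem1 {Ω : Type*} [MeasurableSpace Ω] (P : Measure Ω) [IsProbabilityMeasure P]
    (X : Ω → ℝ) (α β γ δ : ℝ) (hα₀ : 0 < α) (hα₂ : α < 2) (hβ₁ : -1 ≤ β) (hβ₂ : β ≤ 1)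
    (hγ : 0 < γ) (hX : StableMoments.IsStable P X α β γ δ) :
    -- `m^p` is the truncated moment of `X`, finite for `0 ≤ p < α`, and the integrals converge
    (∀ p : ℝ, p < α → StableMoments.posMoment P X p = StableMoments.m p α β γ δ) ∧
    (∀ p : ℝ, 0 ≤ p → p < α →
      StableMoments.m p α β γ δ ≠ ∞ ∧
      IntegrableOn
        (StableMoments.gIntegrand (-p) (-StableMoments.deltaStar α β γ δ) α β) (Ioi 0) ∧
      IntegrableOn
        (StableMoments.gtIntegrand (-p) (-StableMoments.deltaStar α β γ δ) α β) (Ioi 0)) ∧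
    -- (a), `p = 0`
    (StableMoments.m 0 α β γ δ = P {ω | 0 < X ω} ∧
      (StableMoments.m 0 α β γ δ).toReal =
        1 / 2 - 1 / Real.pi * StableMoments.gt 0 (-StableMoments.deltaStar α β γ δ) α β) ∧
    -- (a), `0 < p < min 1 α`
    (∀ p : ℝ, 0 < p → p < min 1 α →
      (StableMoments.m p α β γ δ).toReal =
        γ ^ p * (Real.Gamma (p + 1) / Real.pi) *
          (Real.sin (Real.pi * p / 2) *
              (Real.Gamma (1 - p / α) / p
                - StableMoments.g (-p) (-StableMoments.deltaStar α β γ δ) α β)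
            - Real.cos (Real.pi * p / 2) *
              StableMoments.gt (-p) (-StableMoments.deltaStar α β γ δ) α β)) ∧
    -- (a), `p = 1 < α`
    (1 < α →
      (StableMoments.m 1 α β γ δ).toReal =
        γ * (StableMoments.deltaStar α β γ δ / 2
          + 1 / Real.pi * (Real.Gamma (1 - 1 / α)
              - StableMoments.g (-1) (-StableMoments.deltaStar α β γ δ) α β))) ∧
    -- (a), `1 < p < α`
    (∀ p : ℝ, 1 < p → p < α →
      (StableMoments.m p α β γ δ).toReal =
        γ ^ p * (Real.Gamma (p + 1) / Real.pi) *
          (Real.sin (Real.pi * p / 2) *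
              (Real.Gamma (1 - p / α) / p
                - StableMoments.g (-p) (-StableMoments.deltaStar α β γ δ) α β)
            + Real.cos (Real.pi * p / 2) *
              (StableMoments.deltaStar α β γ δ / α * Real.Gamma ((1 - p) / α)
                - StableMoments.gt (-p) (-StableMoments.deltaStar α β γ δ) α β))) ∧
    -- (b)
    (∀ p : ℝ, p < α →
      StableMoments.negMoment P X p = StableMoments.posMoment P (fun ω => -X ω) p ∧
      StableMoments.posMoment P (fun ω => -X ω) p = StableMoments.m p α (-β) γ (-δ)) := by
  have hlaw := hX.2
  have hν := hlaw.isStandardLaw_map hγ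
  -- The identification with `m` and part (b) are equalities of integrals in `[0, ∞]`, so they hold
  -- for negative `p` as well, with no finiteness required.
  refine ⟨fun p _ => StableMoments.posMoment_eq_m hX p, fun p hp hpα => ⟨?_,
    StableMoments.integrableOn_gIntegrand _ β hα₀ hα₂ hp hpα,
    StableMoments.integrableOn_gtIntegrand _ β hα₀ hα₂ hp hpα⟩,
    ⟨?_, hlaw.m_zero_toReal hα₀ hα₂ hγ⟩, fun p hp hpα => ?_, fun hα₁ => ?_, fun p hp hpα => ?_,
    fun p _ => ⟨StableMoments.negMoment_eq_posMoment_neg P X p,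
      StableMoments.posMoment_eq_m hX.neg p⟩⟩
  · rcases hp.eq_or_lt with rfl | hp
    · have := hlaw.isProbabilityMeasure
      rw [hlaw.m_zero]
      exact measure_ne_top _ _
    · rw [hlaw.m_eq_ofReal hα₂ hγ hp hpα]
      exact ENNReal.ofReal_ne_top
  · rw [hlaw.m_zero, Measure.map_apply_of_aemeasurable hX.1 measurableSet_Ioi]
    rfl
  · rw [hlaw.m_toReal hα₂ hγ hp (hpα.trans_le (min_le_right _ _)),
      hν.positive_moment_of_lt hα₂ hp hpα, mul_assoc]
  · rw [hlaw.m_toReal hα₂ hγ one_pos hα₁, hν.positive_moment_one hα₁ hα₂, Real.rpow_one, neg_neg]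
  · rw [hlaw.m_toReal hα₂ hγ (by linarith) hpα, hν.positive_moment_of_gt hα₂ hp hpα, mul_assoc,
      neg_neg]
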